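/- **Theorem (maximum of the ARFIMA$(0,d,0)$ entropy rate).** Let $d\in(-\tfrac12,\tfrac12)$ and write $d=H-\tfrac12$ with Hurst parameter $H\in(0,1)$. A (Gaussian) ARFIMA$(0,d,0)$ process is a stationary process $(X_n)_{n\in\mathbb Z}$ for which there are i.i.d. innovations $\epsilon_n\sim N(0,\sigma_\epsilon^2)$, $\sigma_\epsilon^2>0$, with $(1-L)^dX_n=\sum_{k\ge0}(-1)^k\binom dk X_{n-k}=\epsilon_n$ for all $n$, and which is causal: there are reals $(c_k)_{k\ge0}$ with $X_n=\sum_{k\ge0}c_k\epsilon_{n-k}$ for all $n$ (both series converging in mean square). The differential entropy rate of $X$ is $\lim_{n\to\infty}\frac1n h(X_1,\dots,X_n)$, where $h(X_1,\dots,X_n)=-\int f_n\log f_n$ and $f_n$ is the joint density of $(X_1,\dots,X_n)$. Fix a process variance $\sigma^2>0$. For every $H\in(0,1)$, ARFIMA$(0,H-\tfrac12,0)$ processes with $\operatorname{Var}(X_n)=\sigma^2$ exist, and all of them have one and the same finite differential entropy rate $h(H)$. The function $h:(0,1)\to\mathbb R$ satisfies $$h(H)<h(\tfrac12)\qquad\text{for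 all }H\in(0,1),\ H\ne\tfrac12,$$ i.e. it attains its maximum at $H=\tfrac12$ and only there. Moreover $h$ is differentiable on $(0,1)$ with $$h'(H)=\psi(2-2H)-\psi(\tfrac32-H),$$ where $\psi=\Gamma'/\Gamma$ is the digamma function, and $h'(H)=0$ if and only if $H=\tfrac12$. -/

import Mathlib

open MeasureTheory ProbabilityTheory Filter Topology

universe u

/-- The series `∑ k, Y k` of random variables converges in mean square to `Z`. -/
def HasMeanSquareSum {Ω : Type*} [MeasurableSpace Ω] (P : Measure Ω)
    (Y : ℕ → Ω → ℝ) (Z : Ω → ℝ) : Prop :=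
  Tendsto (fun N : ℕ => eLpNorm (fun ω => Z ω - ∑ k ∈ Finset.range N, Y k ω) 2 P) atTop (𝓝 0)

/-- (Strict) stationarity of a real process indexed by `ℤ`: the law of the process on the
space `ℤ → ℝ` of paths is invariant under every time shift. -/
def IsStationaryProcess {Ω : Type*} [MeasurableSpace Ω] (P : Measure Ω)
    (X : ℤ → Ω → ℝ) : Prop :=
  ∀ m : ℤ, P.map (fun ω (n : ℤ) => X (n + m) ω) = P.map (fun ω (n : ℤ) => X n ω)

/-- Gaussian white noise: independent `N(0, v)` variables indexed by `ℤ`, with `v > 0`. -/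
structure IsGaussianWhiteNoise {Ω : Type*} [MeasurableSpace Ω] (P : Measure Ω)
    (ε : ℤ → Ω → ℝ) (v : NNReal) : Prop where
  var_pos : 0 < v
  hasLaw : ∀ n, HasLaw (ε n) (gaussianReal 0 v) P
  indep : iIndepFun ε P

/-- The coefficient of `L ^ k` in the binomial series `(1 - L) ^ d = ∑ k, (d choose k) (-L) ^ k`. -/
noncomputable def fracDiffCoeff (d : ℝ) (k : ℕ) : ℝ := (-1) ^ k * Ring.choose d k

/-- `X` is a (Gaussian) ARFIMA(0,d,0) process with innovations `ε` of variance `v`: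
a stationary process satisfying `(1 - L) ^ d X = ε`, the series being taken in mean square,
and causal, i.e. `X` is given by a one-sided moving average of the innovations.

The coefficients of the moving average are left unspecified. Causality only removes from the
solutions of the difference equation the ones with a deterministic component: for `0 < d` the
operator `(1 - L) ^ d` annihilates every process that is constant in time, so that
an arbitrary (possibly random) constant could be added to a solution. -/
structure IsARFIMAWithNoise {Ω : Type*} [MeasurableSpace Ω] (P : Measure Ω) (d : ℝ)
    (X ε : ℤ → Ω → ℝ) (v : NNReal) : Prop where
  aemeasurable : ∀ n, AEMeasurable (X n) P
  stationary : IsStationaryProcess P X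
  noise : IsGaussianWhiteNoise P ε v
  fracDiff_eq : ∀ n : ℤ,
    HasMeanSquareSum P (fun k ω => fracDiffCoeff d k * X (n - (k : ℤ)) ω) (ε n)
  causal : ∃ c : ℕ → ℝ, ∀ n : ℤ,
    HasMeanSquareSum P (fun k ω => c k * ε (n - (k : ℤ)) ω) (X n)

/-- `X` is an ARFIMA(0,d,0) process, with `-1/2 < d < 1/2`. -/
def IsARFIMA {Ω : Type*} [MeasurableSpace Ω] (P : Measure Ω) (d : ℝ)
    (X : ℤ → Ω → ℝ) : Prop :=
  -1 / 2 < d ∧ d < 1 / 2 ∧ ∃ (ε : ℤ → Ω → ℝ) (v : NNReal), IsARFIMAWithNoise P d X ε v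

/-- The density with respect to Lebesgue measure of the law of a random vector. -/
noncomputable def lawDensity {Ω : Type*} [MeasurableSpace Ω] (P : Measure Ω) {n : ℕ}
    (Y : Ω → Fin n → ℝ) (x : Fin n → ℝ) : ℝ :=
  ((P.map Y).rnDeriv volume x).toReal

/-- The random vector `Y` has a density `f`, the function `f log f` is integrable, and the
joint differential entropy `- ∫ f log f` of `Y` (in nats) equals `a`. -/
def HasDifferentialEntropy {Ω : Type*} [MeasurableSpace Ω] (P : Measure Ω) {n : ℕ}
    (Y : Ω → Fin n → ℝ) (a : ℝ) : Prop :=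
  AEMeasurable Y P ∧ P.map Y ≪ volume ∧
    Integrable (fun x => lawDensity P Y x * Real.log (lawDensity P Y x)) volume ∧
    - ∫ x, lawDensity P Y x * Real.log (lawDensity P Y x) = a

/-- The joint differential entropies `h(X₁, …, Xₙ)` exist and `h(X₁, …, Xₙ) / n → r`. -/
def HasDifferentialEntropyRate {Ω : Type*} [MeasurableSpace Ω] (P : Measure Ω)
    (X : ℤ → Ω → ℝ) (r : ℝ) : Prop :=
  ∃ a : ℕ → ℝ,
    (∀ n : ℕ, HasDifferentialEntropy P (fun ω (i : Fin n) => X (((i : ℕ) : ℤ) + 1) ω) (a n)) ∧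
    Tendsto (fun n : ℕ => a n / n) atTop (𝓝 r)

/-- The digamma function `ψ = Γ' / Γ` of a real variable. -/
noncomputable def realDigamma : ℝ → ℝ := logDeriv Real.Gamma

/-! The entropy rate depends only on the innovation variance `v`: it equals `1/2 * log (2πe v)`.
Fixing the process variance turns `v` into an explicit function of `H`, and the rest is calculus.

Coefficients. Comparing `(1 - L)^d X = ε` with the causal expansion forces the moving average
coefficients to be those of `(1 - z)^(-d)`. Gauss's theorem sums their squares
(`tsum_fracDiffCoeff_sq`), so `Var X = v Γ(1-2d) / Γ(1-d)^2`.

Entropy rate. A unit lower triangular Toeplitz matrix sends `(X_1, …, X_n)` to the residuals `y_i`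
of the filter `(1 - L)^d` truncated at the start of the block; its determinant is 1, so entropy is
unchanged. Each `y_i` is the innovation at its time plus noise from times `≤ 0`, so the eigenvalues
of the Gram matrix of `y` are at least `v`. Their sum is `∑ ‖y_i‖^2`, where `‖y_i‖^2 → v` because
the difference equation converges in mean square. As `log x ≤ x - 1`, the entropy per variable is
squeezed to `1/2 * log (2πe v)` (`exists_block_decomposition`,
`IsARFIMAWithNoise.hasDifferentialEntropyRate`).

Existence. On path space, `(1 - z)^(-d)` applied to white noise gives the process. That it solves
the equation is an `ℓ²` estimate on truncated products, obtained from Andersen's identity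
(`tendsto_tsum_truncConv_sub_sq`).

Maximum. Solving for `v` gives `h = const + log Γ(3/2-H) - 1/2 * log Γ(2-2H)`, whose derivative is
`ψ(2-2H) - ψ(3/2-H)`. Since `ψ` is strictly increasing, its sign is that of `1/2 - H`. -/

/-! ### Binomial coefficients of `(1 - z)^d`: identities and decay -/

section Coefficients

lemma fracDiffCoeff_zero (d : ℝ) : fracDiffCoeff d 0 = 1 := by
  simp [fracDiffCoeff]

lemma fracDiffCoeff_succ (d : ℝ) (k : ℕ) :
    ((k : ℝ) + 1) * fracDiffCoeff d (k + 1) = (k - d) * fracDiffCoeff d k := by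
  have hk : ((k.factorial : ℕ) : ℝ) ≠ 0 := by positivity
  have hk1 : ((k : ℝ) + 1) ≠ 0 := by positivity
  simp only [fracDiffCoeff, Ring.choose_eq_smul, descPochhammer_succ_right, smul_eq_mul,
    Polynomial.smeval_mul, Nat.factorial_succ, Polynomial.smeval_sub, Polynomial.smeval_X,
    Polynomial.smeval_natCast, pow_succ]
  push_cast
  field_simp
  simp
  ring

lemma fracDiffCoeff_sub_one_succ (d : ℝ) (n : ℕ) :
    ((n : ℝ) + 1) * fracDiffCoeff (d - 1) (n + 1) = (n + 1 - d) * fracDiffCoeff (d - 1) n := by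
  rw [fracDiffCoeff_succ]; ring

/-- Coefficient form of `((1 - z)^d)' = -d (1 - z)^(d-1)`. -/
lemma succ_mul_fracDiffCoeff_succ (d : ℝ) (n : ℕ) :
    ((n : ℝ) + 1) * fracDiffCoeff d (n + 1) = -d * fracDiffCoeff (d - 1) n := by
  induction n with
  | zero => rw [fracDiffCoeff_succ]; simp [fracDiffCoeff_zero]
  | succ n ih =>
    have h1 := fracDiffCoeff_succ d (n + 1)
    have h2 := fracDiffCoeff_sub_one_succ d n
    have hn : ((n : ℝ) + 1) ≠ 0 := by positivity
    push_cast at h1 ⊢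
    rw [h1]
    apply mul_left_cancel₀ hn
    linear_combination (n + 1 - d) * ih + d * h2

/-- Coefficient form of `(1 - z) (1 - z)^(d-1) = (1 - z)^d`. -/
lemma fracDiffCoeff_sub_one_succ_eq_add (d : ℝ) (n : ℕ) :
    fracDiffCoeff (d - 1) (n + 1) = fracDiffCoeff (d - 1) n + fracDiffCoeff d (n + 1) := by
  have hn : ((n : ℝ) + 1) ≠ 0 := by positivity
  apply mul_left_cancel₀ hn
  linear_combination fracDiffCoeff_sub_one_succ d n - succ_mul_fracDiffCoeff_succ d n

/-- Andersen's identity for the partial sums of the Vandermonde convolution. -/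
lemma add_mul_sum_fracDiffCoeff_mul (d : ℝ) (n p : ℕ) :
    ((n : ℝ) + p) * ∑ k ∈ Finset.range (n + 1), fracDiffCoeff d k * fracDiffCoeff (-d) (n + p - k)
      = p * fracDiffCoeff (d - 1) n * fracDiffCoeff (-d) p := by
  induction n generalizing p with
  | zero => simp [fracDiffCoeff_zero]
  | succ n ih =>
    -- Raising `p` as `n` drops keeps the total `n + p` fixed, so the two sums differ only in their
    -- last term.
    have h := ih (p + 1)
    rw [Finset.sum_range_succ, show n + 1 + p = n + (p + 1) by ring,
      show n + (p + 1) - (n + 1) = p by omega, fracDiffCoeff_sub_one_succ_eq_add]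
    have h1 := fracDiffCoeff_succ (-d) p
    have h2 := succ_mul_fracDiffCoeff_succ d n
    push_cast at h ⊢
    linear_combination h + fracDiffCoeff (d - 1) n * h1 + fracDiffCoeff (-d) p * h2

lemma sum_fracDiffCoeff_mul_neg (d : ℝ) (m : ℕ) :
    ∑ k ∈ Finset.range (m + 1), fracDiffCoeff d k * fracDiffCoeff (-d) (m - k)
      = if m = 0 then 1 else 0 := by
  split_ifs with h
  · subst h; simp [fracDiffCoeff_zero]
  · have := add_mul_sum_fracDiffCoeff_mul d m 0
    simpa [h] using this

/-- The inverse of a sequence with leading term `1` under Cauchy products is unique. -/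
lemma eq_of_cauchyProduct_eq {b c c' : ℕ → ℝ} (hb : b 0 = 1)
    (h : ∀ m, ∑ k ∈ Finset.range (m + 1), b k * c (m - k)
      = ∑ k ∈ Finset.range (m + 1), b k * c' (m - k)) : c = c' := by
  funext m
  induction m using Nat.strong_induction_on with
  | _ m ih =>
    have hm := h m
    rw [Finset.sum_range_succ', Finset.sum_range_succ' _ m] at hm
    have : ∑ k ∈ Finset.range m, b (k + 1) * c (m - (k + 1))
        = ∑ k ∈ Finset.range m, b (k + 1) * c' (m - (k + 1)) := by
      refine Finset.sum_congr rfl fun k hk => ?_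
      rw [ih]
      have := Finset.mem_range.1 hk
      omega
    rw [this] at hm
    simpa [hb] using hm

/-- Consecutive terms have ratio `1 - d/(n+1)`, which is positive and at most `exp (-d/(n+1))`. The
harmonic sum in the exponent is then compared with a logarithm to give the order `n^(-d)`. -/
lemma fracDiffCoeff_sub_one_bounds {d : ℝ} (hd : d < 1) (n : ℕ) :
    0 < fracDiffCoeff (d - 1) n ∧ fracDiffCoeff (d - 1) n ≤ Real.exp (-d * (harmonic n : ℝ)) := by
  induction n with
  | zero => simp [fracDiffCoeff_zero]
  | succ n ih =>
    have hn : (0 : ℝ) < (n : ℝ) + 1 := by positivity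
    have h : fracDiffCoeff (d - 1) (n + 1) = (1 - d / (n + 1)) * fracDiffCoeff (d - 1) n := by
      apply mul_left_cancel₀ hn.ne'
      rw [fracDiffCoeff_sub_one_succ]
      field_simp
    have hpos : 0 < 1 - d / ((n : ℝ) + 1) := by
      rw [sub_pos, div_lt_one hn]
      have : (0 : ℝ) ≤ n := by positivity
      linarith
    rw [h]
    refine ⟨mul_pos hpos ih.1, ?_⟩
    have he : Real.exp (-d * (harmonic (n + 1) : ℝ))
        = Real.exp (-d / (n + 1)) * Real.exp (-d * (harmonic n : ℝ)) := by
      rw [← Real.exp_add, harmonic_succ]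
      push_cast
      congr 1
      field_simp
      ring
    rw [he]
    refine mul_le_mul ?_ ih.2 ih.1.le (Real.exp_pos _).le
    have := Real.add_one_le_exp (-d / ((n : ℝ) + 1))
    rw [neg_div] at this ⊢
    linarith

lemma fracDiffCoeff_sub_one_le {d : ℝ} (hd : d < 1) (n : ℕ) :
    fracDiffCoeff (d - 1) n ≤ Real.exp |d| * ((n : ℝ) + 1) ^ (-d) := by
  refine (fracDiffCoeff_sub_one_bounds hd n).2.trans ?_
  have hn : (0 : ℝ) < (n : ℝ) + 1 := by positivity
  rw [Real.rpow_def_of_pos hn, ← Real.exp_add, Real.exp_le_exp]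
  have h1 := log_add_one_le_harmonic n
  have h2 : (harmonic n : ℝ) ≤ 1 + Real.log (n + 1) := by
    refine (harmonic_le_one_add_log n).trans ?_
    rcases Nat.eq_zero_or_pos n with rfl | h
    · simp
    · gcongr
      linarith
  push_cast at h1
  rcases le_total 0 d with h | h
  · rw [abs_of_nonneg h]; nlinarith
  · rw [abs_of_nonpos h]; nlinarith

lemma abs_fracDiffCoeff_succ_le {d : ℝ} (hd : d < 1) (n : ℕ) :
    |fracDiffCoeff d (n + 1)| ≤ |d| * Real.exp |d| * ((n : ℝ) + 1) ^ (-d - 1) := by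
  have hn : (0 : ℝ) < (n : ℝ) + 1 := by positivity
  have h := succ_mul_fracDiffCoeff_succ d n
  have h' : |fracDiffCoeff d (n + 1)| = |d| * fracDiffCoeff (d - 1) n / ((n : ℝ) + 1) := by
    rw [eq_div_iff hn.ne', mul_comm]
    nth_rewrite 1 [← abs_of_pos hn]
    rw [← abs_mul, h, abs_mul, abs_neg, abs_of_pos (fracDiffCoeff_sub_one_bounds hd n).1]
  rw [h', Real.rpow_sub_one hn.ne', div_le_iff₀ hn, mul_assoc, mul_assoc, div_mul_cancel₀ _ hn.ne']
  exact mul_le_mul_of_nonneg_left (fracDiffCoeff_sub_one_le hd n) (abs_nonneg d)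

lemma fracDiffCoeff_succ_sq_le {d : ℝ} (hd : d < 1) (n : ℕ) :
    fracDiffCoeff d (n + 1) ^ 2
      ≤ (|d| * Real.exp |d|) ^ 2 * ((n : ℝ) + 1) ^ (-2 * d - 2) := by
  have hn : (0 : ℝ) < (n : ℝ) + 1 := by positivity
  rw [← sq_abs]
  refine (pow_le_pow_left₀ (abs_nonneg _) (abs_fracDiffCoeff_succ_le hd n) 2).trans_eq ?_
  rw [mul_pow, ← Real.rpow_natCast (((n : ℝ) + 1) ^ (-d - 1)), ← Real.rpow_mul hn.le]
  congr 2
  push_cast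
  ring

lemma summable_fracDiffCoeff_sq {d : ℝ} (hd : -1 / 2 < d) (hd' : d < 1) :
    Summable fun k => fracDiffCoeff d k ^ 2 := by
  rw [← summable_nat_add_iff 1]
  refine Summable.of_nonneg_of_le (fun _ => sq_nonneg _) (fun n => fracDiffCoeff_succ_sq_le hd' n)
    (Summable.mul_left _ ?_)
  have := (summable_nat_add_iff 1).2 (Real.summable_nat_rpow.2 (show -2 * d - 2 < -1 by linarith))
  simpa using this

/-- Supplies the vanishing boundary term of the telescoping sum in `tsum_gaussTerm_add_one`. -/
lemma tendsto_mul_fracDiffCoeff_sq {d : ℝ} (hd : -1 / 2 < d) (hd' : d < 1) :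
    Tendsto (fun k : ℕ => (k : ℝ) * fracDiffCoeff d k ^ 2) atTop (𝓝 0) := by
  rw [← tendsto_add_atTop_iff_nat 1]
  have h0 : Tendsto (fun n : ℕ => (|d| * Real.exp |d|) ^ 2 * ((n : ℝ) + 1) ^ (-(2 * d + 1))) atTop
      (𝓝 ((|d| * Real.exp |d|) ^ 2 * 0)) := by
    refine Tendsto.const_mul _ ?_
    have := (tendsto_rpow_neg_atTop (show 0 < 2 * d + 1 by linarith)).comp
      (tendsto_natCast_atTop_atTop (R := ℝ) |>.comp (tendsto_add_atTop_nat 1))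
    simpa [Function.comp_def] using this
  rw [mul_zero] at h0
  refine squeeze_zero (fun n => by positivity) (fun n => ?_) h0
  have hn : (0 : ℝ) < (n : ℝ) + 1 := by positivity
  calc ((n + 1 : ℕ) : ℝ) * fracDiffCoeff d (n + 1) ^ 2
      ≤ ((n : ℝ) + 1) * ((|d| * Real.exp |d|) ^ 2 * ((n : ℝ) + 1) ^ (-2 * d - 2)) := by
        push_cast
        exact mul_le_mul_of_nonneg_left (fracDiffCoeff_succ_sq_le hd' n) hn.le
    _ = _ := by
        rw [show -(2 * d + 1) = (-2 * d - 2) + 1 by ring, Real.rpow_add_one hn.ne']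
        ring

end Coefficients

/-! ### Gauss's summation of the squared coefficients -/

section Gauss

/-- The terms of the hypergeometric series `F(-d, -d; m + 1; 1)`. -/
noncomputable def gaussTerm (d : ℝ) (m k : ℕ) : ℝ := fracDiffCoeff d k ^ 2 / ((m + k).choose k)

lemma choose_add_cast_pos (m k : ℕ) : (0 : ℝ) < ((m + k).choose k) :=
  Nat.cast_pos.2 (Nat.choose_pos (Nat.le_add_left _ _))

lemma gaussTerm_nonneg (d : ℝ) (m k : ℕ) : 0 ≤ gaussTerm d m k :=
  div_nonneg (sq_nonneg _) (choose_add_cast_pos m k).le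

lemma gaussTerm_le (d : ℝ) (m k : ℕ) : gaussTerm d m k ≤ fracDiffCoeff d k ^ 2 :=
  div_le_self (sq_nonneg _) (Nat.one_le_cast.2 (Nat.choose_pos (Nat.le_add_left _ _)))

lemma summable_gaussTerm {d : ℝ} (hd : -1 / 2 < d) (hd' : d < 1) (m : ℕ) :
    Summable (gaussTerm d m) :=
  Summable.of_nonneg_of_le (gaussTerm_nonneg d m) (gaussTerm_le d m)
    (summable_fracDiffCoeff_sq hd hd')

lemma gaussTerm_add_one (d : ℝ) (m k : ℕ) :
    gaussTerm d (m + 1) k = gaussTerm d m k * (m + 1) / (m + 1 + k) := by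
  have h := Nat.add_one_mul_choose_eq (m + k) m
  rw [Nat.choose_symm_add, show m + k + 1 = (m + 1) + k by ring, Nat.choose_symm_add] at h
  have h' : (((m + 1 : ℕ) + k : ℕ) : ℝ) * ((m + k).choose k) = ((m + 1 + k).choose k) * (m + 1) := by
    exact_mod_cast h
  have h1 := choose_add_cast_pos m k
  have h2 := choose_add_cast_pos (m + 1) k
  have h3 : (0 : ℝ) < m + 1 + k := by positivity
  push_cast at h'
  simp only [gaussTerm]
  rw [div_mul_eq_mul_div, div_div, div_eq_div_iff h2.ne' (by positivity)]
  linear_combination fracDiffCoeff d k ^ 2 * h'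

lemma gaussTerm_succ (d : ℝ) (m k : ℕ) :
    ((k : ℝ) + 1) * gaussTerm d m (k + 1) = gaussTerm d m k * (k - d) ^ 2 / (m + 1 + k) := by
  have h := Nat.add_one_mul_choose_eq (m + k) k
  have h' : ((m : ℝ) + k + 1) * ((m + k).choose k) = ((m + k + 1).choose (k + 1)) * (k + 1) := by
    exact_mod_cast h
  have h1 := choose_add_cast_pos m k
  have h2 := choose_add_cast_pos m (k + 1)
  have h3 : (0 : ℝ) < m + 1 + k := by positivity
  have h4 := fracDiffCoeff_succ d k
  have h5 : (0 : ℝ) < (k : ℝ) + 1 := by positivity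
  have h6 : fracDiffCoeff d (k + 1) = (k - d) * fracDiffCoeff d k / (k + 1) := by
    rw [eq_div_iff h5.ne', ← h4]; ring
  rw [← add_assoc] at h2
  have h7 : (((m + k + 1).choose (k + 1) : ℕ) : ℝ) = (m + k + 1) * ((m + k).choose k) / (k + 1) := by
    rw [eq_div_iff h5.ne', h']
  simp only [gaussTerm, ← add_assoc]
  rw [h6, h7]
  field_simp
  ring

/-- A contiguous relation in the parameter `m + 1`. After division by `m + 1`, the termwise
difference of the two sides telescopes: its partial sums are `-K * gaussTerm d m K`, which tends to
zero. -/
lemma tsum_gaussTerm_add_one {d : ℝ} (hd : -1 / 2 < d) (hd' : d < 1) (m : ℕ) :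
    ((m : ℝ) + 1) * (m + 1 + 2 * d) * ∑' k, gaussTerm d m k
      = (m + 1 + d) ^ 2 * ∑' k, gaussTerm d (m + 1) k := by
  have hm : (0 : ℝ) < (m : ℝ) + 1 := by positivity
  have hs := (summable_gaussTerm hd hd' m).hasSum.mul_left ((m : ℝ) + 1 + 2 * d)
  have hs1 := (summable_gaussTerm hd hd' (m + 1)).hasSum.mul_left (((m : ℝ) + 1 + d) ^ 2 / (m + 1))
  have hsub := (hs.sub hs1).tendsto_sum_nat
  have htel : ∀ K : ℕ, ∑ k ∈ Finset.range K, (((m : ℝ) + 1 + 2 * d) * gaussTerm d m k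
      - ((m : ℝ) + 1 + d) ^ 2 / (m + 1) * gaussTerm d (m + 1) k) = -(K * gaussTerm d m K) := by
    intro K
    induction K with
    | zero => simp
    | succ K ih =>
      rw [Finset.sum_range_succ, ih]
      push_cast
      rw [gaussTerm_succ, gaussTerm_add_one]
      have h3 : (0 : ℝ) < m + 1 + K := by positivity
      field_simp
      ring
  simp_rw [htel] at hsub
  have h0 : Tendsto (fun K : ℕ => -((K : ℝ) * gaussTerm d m K)) atTop (𝓝 (-0)) := by
    refine Tendsto.neg (squeeze_zero (fun K => ?_) (fun K => ?_)
      (tendsto_mul_fracDiffCoeff_sq hd hd'))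
    · exact mul_nonneg (Nat.cast_nonneg _) (gaussTerm_nonneg d m K)
    · exact mul_le_mul_of_nonneg_left (gaussTerm_le d m K) (Nat.cast_nonneg _)
  have := tendsto_nhds_unique hsub h0
  field_simp at this
  linarith

lemma tendsto_tsum_gaussTerm {d : ℝ} (hd : -1 / 2 < d) (hd' : d < 1) :
    Tendsto (fun m : ℕ => ∑' k, gaussTerm d m k) atTop (𝓝 1) := by
  have h1 : ∑' k : ℕ, (if k = 0 then (1 : ℝ) else 0) = 1 := by simp
  rw [← h1]
  refine tendsto_tsum_of_dominated_convergence (summable_fracDiffCoeff_sq hd hd') (fun k => ?_)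
    (Eventually.of_forall fun m k => ?_)
  · rcases Nat.eq_zero_or_pos k with rfl | hk
    · simp [gaussTerm, fracDiffCoeff_zero]
    · rw [if_neg hk.ne']
      refine squeeze_zero (fun m => gaussTerm_nonneg d m k) (fun m => ?_)
        (tendsto_const_div_atTop_nhds_zero_nat (fracDiffCoeff d k ^ 2) |>.comp
          (tendsto_add_atTop_nat 1))
      refine div_le_div_of_nonneg_left (sq_nonneg _) (by positivity) ?_
      have : m + 1 ≤ (m + k).choose k := by
        obtain ⟨j, rfl⟩ : ∃ j, k = j + 1 := ⟨k - 1, by omega⟩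
        rw [Nat.choose_symm_add.symm]
        calc m + 1 = (m + 1).choose m := by simp
          _ ≤ _ := Nat.choose_le_choose m (by omega)
      exact_mod_cast this
  · rw [Real.norm_of_nonneg (gaussTerm_nonneg d m k)]
    exact gaussTerm_le d m k

/-- Gauss's summation theorem for `F(-d, -d; 1; 1)`. -/
lemma tsum_fracDiffCoeff_sq {d : ℝ} (hd : -1 / 2 < d) (hd' : d < 1) :
    ∑' k, fracDiffCoeff d k ^ 2 = Real.Gamma (1 + 2 * d) / Real.Gamma (1 + d) ^ 2 := by
  have hF0 : ∑' k, fracDiffCoeff d k ^ 2 = ∑' k, gaussTerm d 0 k := by simp [gaussTerm]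
  have hprod : ∀ M : ℕ, (∏ j ∈ Finset.range M, ((j : ℝ) + 1) * (j + 1 + 2 * d)) *
      ∑' k, gaussTerm d 0 k = (∏ j ∈ Finset.range M, ((j : ℝ) + 1 + d)) ^ 2 *
        ∑' k, gaussTerm d M k := by
    intro M
    induction M with
    | zero => simp
    | succ M ih =>
      rw [Finset.prod_range_succ, Finset.prod_range_succ]
      linear_combination ((M : ℝ) + 1) * (M + 1 + 2 * d) * ih +
        (∏ j ∈ Finset.range M, ((j : ℝ) + 1 + d)) ^ 2 * tsum_gaussTerm_add_one hd hd' M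
  -- In this quotient the factorials cancel, and so do the powers of `n` because `(1 + 2d) + 1 = 2(1
  -- + d)`. What remains is the ratio of products in `hprod` at `M = n + 1`.
  have hG : Tendsto (fun n : ℕ => Real.GammaSeq (1 + 2 * d) n * Real.GammaSeq 1 n /
      Real.GammaSeq (1 + d) n ^ 2) atTop
      (𝓝 (Real.Gamma (1 + 2 * d) * Real.Gamma 1 / Real.Gamma (1 + d) ^ 2)) := by
    refine ((Real.GammaSeq_tendsto_Gamma _).mul (Real.GammaSeq_tendsto_Gamma _)).div
      ((Real.GammaSeq_tendsto_Gamma _).pow 2) ?_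
    exact (pow_pos (Real.Gamma_pos_of_pos (by linarith)) 2).ne'
  have hlim := hG.mul ((tendsto_tsum_gaussTerm hd hd').comp (tendsto_add_atTop_nat 1))
  rw [Real.Gamma_one, mul_one, mul_one] at hlim
  rw [hF0]
  refine tendsto_nhds_unique (tendsto_const_nhds.congr' ?_) hlim
  filter_upwards [eventually_gt_atTop 0] with n hn
  have hn' : (0 : ℝ) < n := by exact_mod_cast hn
  have hP := hprod (n + 1)
  rw [Finset.prod_mul_distrib] at hP
  have e1 : ∏ j ∈ Finset.range (n + 1), ((j : ℝ) + 1) = ∏ j ∈ Finset.range (n + 1), ((1 : ℝ) + j) :=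
    Finset.prod_congr rfl fun _ _ => by ring
  have e2 : ∏ j ∈ Finset.range (n + 1), ((j : ℝ) + 1 + 2 * d)
      = ∏ j ∈ Finset.range (n + 1), ((1 + 2 * d : ℝ) + j) :=
    Finset.prod_congr rfl fun _ _ => by ring
  have e3 : ∏ j ∈ Finset.range (n + 1), ((j : ℝ) + 1 + d)
      = ∏ j ∈ Finset.range (n + 1), ((1 + d : ℝ) + j) :=
    Finset.prod_congr rfl fun _ _ => by ring
  have p1 : (0 : ℝ) < ∏ j ∈ Finset.range (n + 1), ((1 : ℝ) + j) :=
    Finset.prod_pos fun _ _ => by positivity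
  have p2 : (0 : ℝ) < ∏ j ∈ Finset.range (n + 1), ((1 + 2 * d : ℝ) + j) :=
    Finset.prod_pos fun j _ => by
      have : (0 : ℝ) ≤ j := by positivity
      linarith
  have p3 : (0 : ℝ) < ∏ j ∈ Finset.range (n + 1), ((1 + d : ℝ) + j) :=
    Finset.prod_pos fun j _ => by
      have : (0 : ℝ) ≤ j := by positivity
      linarith
  rw [e1, e2, e3] at hP
  have hpow : ((n : ℝ) ^ (1 + d)) ^ 2 = (n : ℝ) ^ (1 + 2 * d) * (n : ℝ) ^ (1 : ℝ) := by
    rw [← Real.rpow_natCast, ← Real.rpow_mul hn'.le, ← Real.rpow_add hn']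
    congr 1
    push_cast
    ring
  have q1 : (0 : ℝ) < (n : ℝ) ^ (1 + 2 * d) := Real.rpow_pos_of_pos hn' _
  have q2 : (0 : ℝ) < (n : ℝ) ^ (1 : ℝ) := Real.rpow_pos_of_pos hn' _
  have q3 : (0 : ℝ) < (n.factorial : ℝ) := by positivity
  simp only [Real.GammaSeq, Function.comp, div_pow, mul_pow, hpow]
  generalize ∏ j ∈ Finset.range (n + 1), ((1 : ℝ) + j) = A1 at *
  generalize ∏ j ∈ Finset.range (n + 1), ((1 + 2 * d : ℝ) + j) = A2 at *
  generalize ∏ j ∈ Finset.range (n + 1), ((1 + d : ℝ) + j) = A3 at *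
  generalize (n : ℝ) ^ (1 + 2 * d) = B1 at *
  generalize (n : ℝ) ^ (1 : ℝ) = B2 at *
  field_simp
  linear_combination hP

end Gauss

/-! ### `ℓ²` error of the truncated inverse filter -/

section Truncation

/-- The coefficients of the product of the truncation of `b` to the first `N` terms with `c`. -/
noncomputable def truncConv (b c : ℕ → ℝ) (N m : ℕ) : ℝ :=
  ∑ k ∈ (Finset.range N).filter (· ≤ m), b k * c (m - k)

lemma truncConv_of_lt (b c : ℕ → ℝ) {N m : ℕ} (h : m < N) :
    truncConv b c N m = ∑ k ∈ Finset.range (m + 1), b k * c (m - k) := by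
  refine Finset.sum_congr ?_ fun _ _ => rfl
  ext k
  simp only [Finset.mem_filter, Finset.mem_range]
  omega

lemma truncConv_succ_add (b c : ℕ → ℝ) (n p : ℕ) :
    truncConv b c (n + 1) (n + p) = ∑ k ∈ Finset.range (n + 1), b k * c (n + p - k) := by
  refine Finset.sum_congr ?_ fun _ _ => rfl
  ext k
  simp only [Finset.mem_filter, Finset.mem_range]
  omega

lemma truncConv_fracDiffCoeff_sq_le {d : ℝ} (hd : -1 / 2 < d) (hd' : d < 1 / 2) (n p : ℕ) :
    truncConv (fracDiffCoeff d) (fracDiffCoeff (-d)) (n + 1) (n + (p + 1)) ^ 2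
      ≤ (4 * (Real.exp |d| * (|d| * Real.exp |d|)) ^ 2) *
        (((n : ℝ) + 1) ^ (-(d + 1 / 2)) * ((p : ℝ) + 1) ^ (d - 3 / 2)) := by
  set C := Real.exp |d| * (|d| * Real.exp |d|) with hC
  have hn : (0 : ℝ) < (n : ℝ) + 1 := by positivity
  have hp : (0 : ℝ) < (p : ℝ) + 1 := by positivity
  have hA := add_mul_sum_fracDiffCoeff_mul d n (p + 1)
  rw [truncConv_succ_add]
  set S := ∑ k ∈ Finset.range (n + 1), fracDiffCoeff d k * fracDiffCoeff (-d) (n + (p + 1) - k)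
  have h1 := fracDiffCoeff_sub_one_le (show d < 1 by linarith) n
  have h1' := fracDiffCoeff_sub_one_bounds (show d < 1 by linarith) n
  have h2 := abs_fracDiffCoeff_succ_le (show -d < 1 by linarith) p
  rw [abs_neg, neg_neg] at h2
  have hnp : (0 : ℝ) < (n : ℝ) + ((p + 1 : ℕ) : ℝ) := by positivity
  have hS : ((n : ℝ) + ((p + 1 : ℕ) : ℝ)) * |S| ≤
      C * (((n : ℝ) + 1) ^ (-d) * ((p : ℝ) + 1) ^ d) := by
    rw [← abs_of_pos hnp, ← abs_mul, hA, abs_mul, abs_mul, abs_of_pos h1'.1, abs_of_nonneg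
      (Nat.cast_nonneg _)]
    calc ((p + 1 : ℕ) : ℝ) * fracDiffCoeff (d - 1) n * |fracDiffCoeff (-d) (p + 1)|
        ≤ ((p + 1 : ℕ) : ℝ) * (Real.exp |d| * ((n : ℝ) + 1) ^ (-d)) *
          (|d| * Real.exp |d| * ((p : ℝ) + 1) ^ (d - 1)) := by gcongr
      _ = _ := by
        rw [Real.rpow_sub_one hp.ne']
        push_cast
        field_simp
        rw [hC]
        ring
  -- Weighted AM-GM splits the denominator `n + p + 1` into powers of `n + 1` and `p + 1`. With this
  -- `θ`, the squared bound has exponent `-(d + 1/2) < 0` in `n + 1` and `d - 3/2 < -1` in `p + 1`: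
  -- decay in `n`, summability in `p`.
  set θ : ℝ := 1 / 4 - d / 2 with hθ
  have hAG : ((n : ℝ) + 1) ^ θ * ((p : ℝ) + 1) ^ (1 - θ) ≤ 2 * ((n : ℝ) + ((p + 1 : ℕ) : ℝ)) := by
    refine (Real.geom_mean_le_arith_mean2_weighted (by linarith) (by linarith) hn.le hp.le
      (by ring)).trans ?_
    push_cast
    have : (0 : ℝ) ≤ n := by positivity
    have : (0 : ℝ) ≤ p := by positivity
    nlinarith [mul_nonneg (show 0 ≤ θ by linarith) hp.le,
      mul_nonneg (show 0 ≤ 1 - θ by linarith) hn.le]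
  have hS2 : ((n : ℝ) + 1) ^ θ * ((p : ℝ) + 1) ^ (1 - θ) * |S| ≤
      2 * (C * (((n : ℝ) + 1) ^ (-d) * ((p : ℝ) + 1) ^ d)) := by
    calc _ ≤ 2 * ((n : ℝ) + ((p + 1 : ℕ) : ℝ)) * |S| :=
          mul_le_mul_of_nonneg_right hAG (abs_nonneg _)
      _ = 2 * (((n : ℝ) + ((p + 1 : ℕ) : ℝ)) * |S|) := by ring
      _ ≤ _ := by gcongr
  have hS3 : |S| ≤ 2 * C * (((n : ℝ) + 1) ^ (-d - θ) * ((p : ℝ) + 1) ^ (d - (1 - θ))) := by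
    rw [Real.rpow_sub hn, Real.rpow_sub hp]
    have a1 := Real.rpow_pos_of_pos hn θ
    have a2 := Real.rpow_pos_of_pos hp (1 - θ)
    rw [div_mul_div_comm, ← mul_div_assoc, le_div_iff₀ (mul_pos a1 a2)]
    linarith
  rw [← sq_abs]
  refine (pow_le_pow_left₀ (abs_nonneg _) hS3 2).trans_eq ?_
  rw [mul_pow, mul_pow (((n : ℝ) + 1) ^ _), ← Real.rpow_natCast (((n : ℝ) + 1) ^ _),
    ← Real.rpow_natCast (((p : ℝ) + 1) ^ _), ← Real.rpow_mul hn.le, ← Real.rpow_mul hp.le]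
  have e1 : (-d - θ) * ((2 : ℕ) : ℝ) = -(d + 1 / 2) := by rw [hθ]; push_cast; ring
  have e2 : (d - (1 - θ)) * ((2 : ℕ) : ℝ) = d - 3 / 2 := by rw [hθ]; push_cast; ring
  rw [e1, e2]
  ring

lemma truncConv_fracDiffCoeff_of_lt (d : ℝ) {N m : ℕ} (h : m < N) :
    truncConv (fracDiffCoeff d) (fracDiffCoeff (-d)) N m = if m = 0 then 1 else 0 := by
  rw [truncConv_of_lt _ _ h, sum_fracDiffCoeff_mul_neg]

/-- The `ℓ²` distance between `(1 - z) ^ d`, truncated to its first `N` terms, times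
`(1 - z) ^ (-d)`, and `1`, tends to zero. -/
lemma tendsto_tsum_truncConv_sub_sq {d : ℝ} (hd : -1 / 2 < d) (hd' : d < 1 / 2) :
    Tendsto (fun N : ℕ => ∑' m, (truncConv (fracDiffCoeff d) (fracDiffCoeff (-d)) N m
      - if m = 0 then 1 else 0) ^ 2) atTop (𝓝 0) := by
  rw [← tendsto_add_atTop_iff_nat 1]
  set K : ℝ := 4 * (Real.exp |d| * (|d| * Real.exp |d|)) ^ 2
  have hsum : Summable fun p : ℕ => ((p : ℝ) + 1) ^ (d - 3 / 2) := by
    have := (summable_nat_add_iff 1).2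
      (Real.summable_nat_rpow.2 (show d - 3 / 2 < -1 by linarith))
    simpa using this
  have hlim : Tendsto (fun n : ℕ => K * (((n : ℝ) + 1) ^ (-(d + 1 / 2)) *
      ∑' p : ℕ, ((p : ℝ) + 1) ^ (d - 3 / 2))) atTop
      (𝓝 (K * (0 * ∑' p : ℕ, ((p : ℝ) + 1) ^ (d - 3 / 2)))) := by
    refine Tendsto.const_mul _ (Tendsto.mul_const _ ?_)
    have := (tendsto_rpow_neg_atTop (show 0 < d + 1 / 2 by linarith)).comp
      (tendsto_natCast_atTop_atTop (R := ℝ) |>.comp (tendsto_add_atTop_nat 1))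
    simpa [Function.comp_def] using this
  rw [zero_mul, mul_zero] at hlim
  refine squeeze_zero (fun n => tsum_nonneg fun _ => sq_nonneg _) (fun n => ?_) hlim
  set f : ℕ → ℝ := fun m => (truncConv (fracDiffCoeff d) (fracDiffCoeff (-d)) (n + 1) m
      - if m = 0 then 1 else 0) ^ 2
  -- Below the truncation order the product is exactly 1, so only the tail contributes.
  have hf0 : ∀ m < n + 1, f m = 0 := fun m hm => by
    simp only [f]; rw [truncConv_fracDiffCoeff_of_lt d hm]; simp
  have hfp : ∀ p : ℕ, f (p + (n + 1)) ≤ K * (((n : ℝ) + 1) ^ (-(d + 1 / 2)) *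
      ((p : ℝ) + 1) ^ (d - 3 / 2)) := fun p => by
    have := truncConv_fracDiffCoeff_sq_le hd hd' n p
    simp only [f]
    rw [if_neg (by omega), sub_zero, show p + (n + 1) = n + (p + 1) by ring]
    exact this
  have hs' := (hsum.mul_left (((n : ℝ) + 1) ^ (-(d + 1 / 2)))).mul_left K
  have hfs : Summable fun p => f (p + (n + 1)) :=
    Summable.of_nonneg_of_le (fun _ => sq_nonneg _) hfp hs'
  have hfs' : Summable f := (summable_nat_add_iff (n + 1)).1 hfs
  rw [← hfs'.sum_add_tsum_nat_add (n + 1),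
    Finset.sum_eq_zero fun m hm => hf0 m (Finset.mem_range.1 hm), zero_add, ← tsum_mul_left,
    ← tsum_mul_left]
  exact hfs.tsum_le_tsum hfp hs'

end Truncation

/-! ### Strict monotonicity of the digamma function -/

section Digamma

lemma hasDerivAt_log_Gamma {x : ℝ} (hx : 0 < x) :
    HasDerivAt (fun y => Real.log (Real.Gamma y)) (realDigamma x) x := by
  have hd : DifferentiableAt ℝ Real.Gamma x := Real.differentiableAt_Gamma fun m => by
    have : (0 : ℝ) ≤ m := by positivity
    linarith
  have := hd.hasDerivAt.log (Real.Gamma_pos_of_pos hx).ne'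
  rwa [realDigamma, logDeriv_apply]

lemma realDigamma_add_one {x : ℝ} (hx : 0 < x) :
    realDigamma (x + 1) = realDigamma x + 1 / x := by
  have h1 : HasDerivAt (fun y => Real.log (Real.Gamma (y + 1))) (realDigamma (x + 1)) x := by
    simpa using (hasDerivAt_log_Gamma (x := x + 1) (by linarith)).comp_add_const x 1
  have h2 : HasDerivAt (fun y => Real.log (Real.Gamma y) + Real.log y) (realDigamma x + 1 / x) x := by
    rw [one_div]
    exact (hasDerivAt_log_Gamma hx).add (Real.hasDerivAt_log hx.ne')
  refine h1.unique (h2.congr_of_eventuallyEq ?_)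
  filter_upwards [lt_mem_nhds hx] with y hy
  rw [Real.Gamma_add_one hy.ne', Real.log_mul hy.ne' (Real.Gamma_pos_of_pos hy).ne', add_comm]

lemma realDigamma_monotoneOn : MonotoneOn realDigamma (Set.Ioi 0) := by
  have h : MonotoneOn (deriv (fun y => Real.log (Real.Gamma y))) (Set.Ioi 0) :=
    Real.convexOn_log_Gamma.monotoneOn_deriv fun x hx =>
      (hasDerivAt_log_Gamma hx).differentiableAt
  intro x hx y hy hxy
  have := h hx hy hxy
  rwa [(hasDerivAt_log_Gamma hx).deriv, (hasDerivAt_log_Gamma hy).deriv] at this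

/-- Log-convexity of `Γ` gives only weak monotonicity. Applying it at `x + 1`, `y + 1` and
descending by `ψ(x + 1) = ψ(x) + 1/x` gains the strict inequality `1/y < 1/x`. -/
lemma realDigamma_strictMonoOn : StrictMonoOn realDigamma (Set.Ioi 0) := by
  intro x hx y hy hxy
  simp only [Set.mem_Ioi] at hx hy
  have h := realDigamma_monotoneOn (Set.mem_Ioi.2 (by linarith : 0 < x + 1))
    (Set.mem_Ioi.2 (by linarith : 0 < y + 1)) (by linarith)
  rw [realDigamma_add_one hx, realDigamma_add_one hy] at h
  have := one_div_lt_one_div_of_lt hx hxy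
  linarith

end Digamma

/-! ### Moving averages of an orthogonal sequence in an inner product space -/

section MovingAverage

open scoped InnerProductSpace

variable {E : Type*} [NormedAddCommGroup E] [InnerProductSpace ℝ E]

/-- A sequence of vectors that are orthogonal to each other and all have squared norm `v`. -/
def IsWhite (e : ℤ → E) (v : ℝ) : Prop := ∀ i j, ⟪e i, e j⟫_ℝ = if i = j then v else 0

/-- `x` is the moving average of the sequence `e` at time `n` with coefficients `c`. -/
def IsMovingAverage (e : ℤ → E) (c : ℕ → ℝ) (n : ℤ) (x : E) : Prop :=
  Tendsto (fun N : ℕ => ∑ k ∈ Finset.range N, c k • e (n - k)) atTop (𝓝 x)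

variable {e : ℤ → E} {v : ℝ}

lemma IsWhite.norm_sq (he : IsWhite e v) (n : ℤ) : ‖e n‖ ^ 2 = v := by
  rw [← real_inner_self_eq_norm_sq, he]; simp

lemma IsWhite.inner_sum (he : IsWhite e v) (c : ℕ → ℝ) (n : ℤ) (m N : ℕ) :
    ⟪∑ k ∈ Finset.range N, c k • e (n - k), e (n - m)⟫_ℝ = if m < N then v * c m else 0 := by
  simp [sum_inner, real_inner_smul_left, he _ _, mul_comm]

lemma IsWhite.norm_sq_sum (he : IsWhite e v) (c : ℕ → ℝ) (n : ℤ) (N : ℕ) :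
    ‖∑ k ∈ Finset.range N, c k • e (n - k)‖ ^ 2 = ∑ k ∈ Finset.range N, v * c k ^ 2 := by
  rw [← real_inner_self_eq_norm_sq, _root_.inner_sum]
  refine Finset.sum_congr rfl fun m hm => ?_
  rw [real_inner_smul_right, he.inner_sum, if_pos (Finset.mem_range.1 hm)]
  ring

lemma IsMovingAverage.hasSum_sq {c : ℕ → ℝ} {n : ℤ} {x : E} (hx : IsMovingAverage e c n x)
    (he : IsWhite e v) (hv : 0 ≤ v) : HasSum (fun k => v * c k ^ 2) (‖x‖ ^ 2) := by
  rw [hasSum_iff_tendsto_nat_of_nonneg fun k => mul_nonneg hv (sq_nonneg _)]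
  simpa only [he.norm_sq_sum] using hx.norm.pow 2

lemma IsMovingAverage.inner_eq {c : ℕ → ℝ} {n : ℤ} {x : E} (hx : IsMovingAverage e c n x)
    (he : IsWhite e v) (m : ℕ) : ⟪x, e (n - m)⟫_ℝ = v * c m := by
  refine tendsto_nhds_unique (hx.inner tendsto_const_nhds) (tendsto_const_nhds.congr' ?_)
  filter_upwards [eventually_gt_atTop m] with N hN
  rw [he.inner_sum, if_pos hN]

lemma IsMovingAverage.inner_eq_zero {c : ℕ → ℝ} {n j : ℤ} {x : E} (hx : IsMovingAverage e c n x)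
    (he : IsWhite e v) (hj : n < j) : ⟪x, e j⟫_ℝ = 0 := by
  refine tendsto_nhds_unique (hx.inner tendsto_const_nhds) (tendsto_const_nhds.congr fun N => ?_)
  rw [sum_inner, Finset.sum_eq_zero fun k _ => ?_]
  rw [real_inner_smul_left, he, if_neg (by omega), mul_zero]

lemma isMovingAverage_self (e : ℤ → E) (n : ℤ) :
    IsMovingAverage e (fun m => if m = 0 then 1 else 0) n (e n) := by
  refine tendsto_const_nhds.congr' ?_
  filter_upwards [eventually_gt_atTop 0] with N hN
  simp [hN]

lemma IsMovingAverage.sub {c c' : ℕ → ℝ} {n : ℤ} {x x' : E} (hx : IsMovingAverage e c n x)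
    (hx' : IsMovingAverage e c' n x') : IsMovingAverage e (fun m => c m - c' m) n (x - x') := by
  simpa [IsMovingAverage, sub_smul] using Tendsto.sub hx hx'

lemma IsMovingAverage.shift {c : ℕ → ℝ} {n : ℤ} {x : E} {k : ℕ}
    (hx : IsMovingAverage e c (n - k) x) :
    IsMovingAverage e (fun m => if k ≤ m then c (m - k) else 0) n x := by
  rw [IsMovingAverage, ← tendsto_add_atTop_iff_nat k]
  refine hx.congr fun N => ?_
  have h0 : ∑ m ∈ Finset.range k, (if k ≤ m then c (m - k) else 0) • e (n - m) = 0 :=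
    Finset.sum_eq_zero fun m hm => by
      rw [if_neg (by have := Finset.mem_range.1 hm; omega), zero_smul]
  rw [add_comm N k, Finset.sum_range_add, h0, zero_add]
  refine Finset.sum_congr rfl fun m _ => ?_
  rw [if_pos (Nat.le_add_right k m), Nat.add_sub_cancel_left]
  congr 2
  push_cast
  ring

/-- A finite filter of shifted moving averages is again a moving average, so questions about
truncated filters become questions about real sequences. -/
lemma IsMovingAverage.truncConv {b c : ℕ → ℝ} {x : ℤ → E} (hx : ∀ n, IsMovingAverage e c n (x n))
    (n : ℤ) (N : ℕ) : IsMovingAverage e (truncConv b c N) n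
      (∑ k ∈ Finset.range N, b k • x (n - k)) := by
  have := tendsto_finsetSum (Finset.range N) fun k _ => ((hx (n - k)).shift).const_smul (b k)
  refine this.congr fun M => ?_
  simp_rw [Finset.smul_sum]
  rw [Finset.sum_comm]
  refine Finset.sum_congr rfl fun m _ => ?_
  simp only [_root_.truncConv, Finset.sum_filter, Finset.sum_smul, smul_smul]
  refine Finset.sum_congr rfl fun k _ => ?_
  split_ifs <;> simp

/-- The coefficients of a causal solution of `∑ k, b k • x (n - k) = e n`. -/
lemma cauchyProduct_eq_of_inverse {b c : ℕ → ℝ} {x : ℤ → E} (he : IsWhite e v) (hv : v ≠ 0)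
    (hx : ∀ n, IsMovingAverage e c n (x n)) {n : ℤ}
    (hb : Tendsto (fun N : ℕ => ∑ k ∈ Finset.range N, b k • x (n - k)) atTop (𝓝 (e n))) (m : ℕ) :
    ∑ k ∈ Finset.range (m + 1), b k * c (m - k) = if m = 0 then 1 else 0 := by
  have h1 := (isMovingAverage_self e n).inner_eq he m
  have h2 : Tendsto (fun N : ℕ => v * truncConv b c N m) atTop (𝓝 ⟪e n, e (n - m)⟫_ℝ) :=
    (hb.inner tendsto_const_nhds).congr fun N => (IsMovingAverage.truncConv hx n N).inner_eq he m
  -- The coefficient at lag `m` no longer changes once `N > m`, so its limit is the full Cauchy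
  -- product.
  have h3 : Tendsto (fun N : ℕ => v * truncConv b c N m) atTop
      (𝓝 (v * ∑ k ∈ Finset.range (m + 1), b k * c (m - k))) := by
    refine tendsto_const_nhds.congr' ?_
    filter_upwards [eventually_gt_atTop m] with N hN
    rw [truncConv_of_lt _ _ hN]
  exact mul_left_cancel₀ hv ((tendsto_nhds_unique h3 h2).trans h1)

lemma IsWhite.exists_isMovingAverage [CompleteSpace E] (he : IsWhite e v) {c : ℕ → ℝ}
    (hc : Summable fun k => c k ^ 2) (n : ℤ) : ∃ x, IsMovingAverage e c n x := by
  refine cauchySeq_tendsto_of_complete ?_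
  have hcs := ((hc.mul_left v).hasSum.tendsto_sum_nat).cauchySeq
  rw [Metric.cauchySeq_iff'] at hcs ⊢
  intro ε hε
  obtain ⟨N, hN⟩ := hcs (ε ^ 2) (by positivity)
  refine ⟨N, fun M hM => ?_⟩
  have h := hN M hM
  rw [dist_eq_norm, ← Finset.sum_Ico_eq_sub _ hM] at h ⊢
  refine lt_of_pow_lt_pow_left₀ 2 hε.le (lt_of_le_of_lt (le_of_eq ?_) (lt_of_abs_lt h))
  -- Zeroing the coefficients before `N` turns a block of the series into an initial sum, to which
  -- `norm_sq_sum` applies.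
  have e1 : ∀ f : ℕ → E, ∑ k ∈ Finset.Ico N M, f k =
      ∑ k ∈ Finset.range M, if N ≤ k then f k else 0 := fun f => by
    rw [← Finset.sum_filter]
    refine Finset.sum_congr ?_ fun _ _ => rfl
    ext k; simp only [Finset.mem_Ico, Finset.mem_filter, Finset.mem_range]; omega
  have e2 : ∀ f : ℕ → ℝ, ∑ k ∈ Finset.Ico N M, f k =
      ∑ k ∈ Finset.range M, if N ≤ k then f k else 0 := fun f => by
    rw [← Finset.sum_filter]
    refine Finset.sum_congr ?_ fun _ _ => rfl
    ext k; simp only [Finset.mem_Ico, Finset.mem_filter, Finset.mem_range]; omega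
  have := he.norm_sq_sum (fun k => if N ≤ k then c k else 0) n M
  rw [e1, e2]
  simp only [ite_smul, zero_smul] at this
  rw [this]
  refine Finset.sum_congr rfl fun k _ => ?_
  split_ifs <;> simp

/-- By Pythagoras, the squared error is `v` times the `ℓ²` error in `tendsto_tsum_truncConv_sub_sq`.
-/
lemma tendsto_sum_fracDiffCoeff_smul {d : ℝ} (hd : -1 / 2 < d) (hd' : d < 1 / 2) {x : ℤ → E}
    (he : IsWhite e v) (hv : 0 ≤ v) (hx : ∀ n, IsMovingAverage e (fracDiffCoeff (-d)) n (x n))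
    (n : ℤ) : Tendsto (fun N : ℕ => ∑ k ∈ Finset.range N, fracDiffCoeff d k • x (n - k)) atTop
      (𝓝 (e n)) := by
  rw [tendsto_iff_norm_sub_tendsto_zero]
  have h := (tendsto_tsum_truncConv_sub_sq hd hd').const_mul v
  have h' : ∀ N : ℕ, v * ∑' m, (truncConv (fracDiffCoeff d) (fracDiffCoeff (-d)) N m
      - if m = 0 then 1 else 0) ^ 2 =
      ‖∑ k ∈ Finset.range N, fracDiffCoeff d k • x (n - k) - e n‖ ^ 2 := fun N => by
    rw [← tsum_mul_left]
    exact (((IsMovingAverage.truncConv hx n N).sub (isMovingAverage_self e n)).hasSum_sq he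
      hv).tsum_eq
  simp_rw [h', mul_zero] at h
  simpa [Real.sqrt_sq (norm_nonneg _)] using h.sqrt

end MovingAverage

/-! ### Volume preserving decorrelation of a block -/

section Diagonalization

open scoped InnerProductSpace

variable {E : Type*} [NormedAddCommGroup E] [InnerProductSpace ℝ E]

lemma inner_linearCombination {n : ℕ} (y : Fin n → E) (s t : Fin n → ℝ) :
    ⟪∑ i, s i • y i, ∑ j, t j • y j⟫_ℝ = s ⬝ᵥ (Matrix.gram ℝ y).mulVec t := by
  simp only [sum_inner, inner_sum, real_inner_smul_left, real_inner_smul_right, dotProduct,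
    Matrix.mulVec, Matrix.gram_apply, Finset.mul_sum]
  rw [Finset.sum_comm]
  refine Finset.sum_congr rfl fun i _ => Finset.sum_congr rfl fun j _ => by ring

/-- Principal components of a finite family of vectors. -/
lemma exists_orthogonal_decomposition {n : ℕ} (y : Fin n → E) {v : ℝ}
    (hy : ∀ t : Fin n → ℝ, v * ∑ i, t i ^ 2 ≤ ‖∑ i, t i • y i‖ ^ 2) :
    ∃ (U : Matrix (Fin n) (Fin n) ℝ) (w : Fin n → E) (l : Fin n → ℝ), |U.det| = 1 ∧
      (∀ i, y i = ∑ k, U i k • w k) ∧ (∀ k, w k = ∑ i, U i k • y i) ∧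
      (∀ i j, ⟪w i, w j⟫_ℝ = if i = j then l i else 0) ∧
      (∀ k, v ≤ l k) ∧ ∑ k, l k = ∑ i, ‖y i‖ ^ 2 := by
  have hG : (Matrix.gram ℝ y).IsHermitian := (Matrix.posSemidef_gram ℝ y).isHermitian
  set U : Matrix (Fin n) (Fin n) ℝ := (hG.eigenvectorUnitary : Matrix (Fin n) (Fin n) ℝ)
  have hU1 : U.transpose * U = 1 := by
    have := Matrix.UnitaryGroup.star_mul_self hG.eigenvectorUnitary
    simpa [Matrix.star_eq_conjTranspose] using this
  have hU2 : U * U.transpose = 1 := mul_eq_one_comm.1 hU1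
  have hdiag : U.transpose * Matrix.gram ℝ y * U = Matrix.diagonal hG.eigenvalues := by
    have := hG.conjStarAlgAut_star_eigenvectorUnitary
    rw [Unitary.conjStarAlgAut_star_apply] at this
    simpa [Matrix.star_eq_conjTranspose, Function.comp_def] using this
  set w : Fin n → E := fun k => ∑ i, U i k • y i
  have hw : ∀ i j, ⟪w i, w j⟫_ℝ = if i = j then hG.eigenvalues i else 0 := fun i j => by
    rw [inner_linearCombination, ← Matrix.diagonal_apply, ← hdiag, Matrix.mul_assoc,
      Matrix.mul_apply]
    rfl
  have hnorm : ∀ k, ∑ i, U i k ^ 2 = 1 := fun k => by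
    have := congrFun (congrFun hU1 k) k
    simpa [Matrix.mul_apply, sq] using this
  refine ⟨U, w, hG.eigenvalues, ?_, fun i => ?_, fun k => rfl, hw, fun k => ?_, ?_⟩
  · have := congrArg Matrix.det hU1
    rw [Matrix.det_mul, Matrix.det_transpose, Matrix.det_one] at this
    rw [← abs_one, abs_eq_abs]
    exact mul_self_eq_one_iff.1 this
  · simp only [w, Finset.smul_sum, smul_smul]
    rw [Finset.sum_comm]
    simp_rw [← Finset.sum_smul]
    have : ∀ j, ∑ k, U i k * U j k = if i = j then 1 else 0 := fun j => by
      rw [← Matrix.one_apply, ← hU2, Matrix.mul_apply]; rfl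
    simp [this]
  · have h1 := hy fun i => U i k
    rw [hnorm, mul_one, ← real_inner_self_eq_norm_sq] at h1
    exact h1.trans_eq ((hw k k).trans (if_pos rfl))
  · have := hG.trace_eq_sum_eigenvalues
    simp only [Matrix.trace, Matrix.diag, Matrix.gram_apply, RCLike.ofReal_real_eq_id, id] at this
    rw [← this]
    exact Finset.sum_congr rfl fun i _ => real_inner_self_eq_norm_sq _

/-- The lower triangular Toeplitz matrix of a sequence. -/
def lowerToeplitz (b : ℕ → ℝ) (n : ℕ) : Matrix (Fin n) (Fin n) ℝ :=
  Matrix.of fun i j => if (j : ℕ) ≤ i then b (i - j) else 0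

lemma det_lowerToeplitz {b : ℕ → ℝ} (hb : b 0 = 1) (n : ℕ) : (lowerToeplitz b n).det = 1 := by
  rw [Matrix.det_of_isLowerTriangular]
  · simp [lowerToeplitz, hb]
  · intro i j hij
    exact if_neg (not_le.2 (Fin.lt_def.1 (OrderDual.toDual_lt_toDual.1 hij)))

lemma sum_lowerToeplitz_smul (b : ℕ → ℝ) (x : ℤ → E) {n : ℕ} (i : Fin n) :
    ∑ j, lowerToeplitz b n i j • x ((j : ℕ) + 1) =
      ∑ k ∈ Finset.range ((i : ℕ) + 1), b k • x (((i : ℕ) : ℤ) + 1 - k) := by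
  have h := Fin.sum_univ_eq_sum_range
    (fun j : ℕ => (if j ≤ (i : ℕ) then b (i - j) else 0) • x ((j : ℤ) + 1)) n
  simp only [lowerToeplitz, Matrix.of_apply]
  rw [h, ← Finset.sum_range_reflect _ ((i : ℕ) + 1)]
  simp only [ite_smul, zero_smul]
  rw [← Finset.sum_filter]
  have hf : (Finset.range n).filter (· ≤ (i : ℕ)) = Finset.range (i + 1) := by
    ext k
    have := i.2
    simp only [Finset.mem_filter, Finset.mem_range]
    omega
  rw [hf]
  refine Finset.sum_congr rfl fun j hj => ?_
  have hj' := Finset.mem_range.1 hj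
  congr 2
  omega

/-- A block of a linear process in terms of principal components of its truncated innovations. -/
lemma exists_block_decomposition {e : ℤ → E} {v : ℝ} (he : IsWhite e v) (hv : 0 < v)
    {b c : ℕ → ℝ} {x : ℤ → E} (hb : b 0 = 1)
    (hbc : ∀ m, ∑ k ∈ Finset.range (m + 1), b k * c (m - k) = if m = 0 then 1 else 0)
    (hx : ∀ n, IsMovingAverage e c n (x n)) (n : ℕ) :
    ∃ (A : Matrix (Fin n) (Fin n) ℝ) (w : Fin n → E) (l : Fin n → ℝ), |A.det| = 1 ∧
      (∀ j : Fin n, x ((j : ℕ) + 1) = ∑ k, A j k • w k) ∧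
      (∀ k, w k ∈ Submodule.span ℝ (Set.range x)) ∧
      (∀ i j, ⟪w i, w j⟫_ℝ = if i = j then l i else 0) ∧ (∀ k, v ≤ l k) ∧
      ∑ k, l k = ∑ i ∈ Finset.range n, ‖∑ k ∈ Finset.range (i + 1), b k • x (0 - k)‖ ^ 2 := by
  set B := lowerToeplitz b n
  have hB : B.det = 1 := det_lowerToeplitz hb n
  set y : Fin n → E := fun i => ∑ j, B i j • x ((j : ℕ) + 1)
  have hyma : ∀ i : Fin n, IsMovingAverage e (truncConv b c (i + 1)) ((i : ℕ) + 1) (y i) :=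
    fun i => by
      simp only [y, B, sum_lowerToeplitz_smul]
      exact IsMovingAverage.truncConv hx _ _
  -- The filter at index `i` reaches back exactly to time 1, so `y i` is `e (i + 1)` plus noise from
  -- times `≤ 0`: within the block it correlates only with its own innovation.
  have hye : ∀ i j : Fin n, ⟪y i, e ((j : ℕ) + 1)⟫_ℝ = if i = j then v else 0 := fun i j => by
    rcases lt_or_ge (i : ℕ) j with h | h
    · rw [(hyma i).inner_eq_zero he (by omega), if_neg (by intro h'; simp [h'] at h)]
    · have := (hyma i).inner_eq he (i - j)
      rw [truncConv_of_lt _ _ (by omega), hbc] at this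
      rw [show ((j : ℕ) : ℤ) + 1 = ((i : ℕ) : ℤ) + 1 - ((i - j : ℕ) : ℤ) by omega, this]
      by_cases hij : i = j
      · simp [hij]
      · have : ¬ ((i : ℕ) - j = 0) := fun h0 => hij (Fin.ext (by omega))
        simp [hij, this]
  -- Cauchy–Schwarz against the same combination of innovations.
  have hlow : ∀ t : Fin n → ℝ, v * ∑ i, t i ^ 2 ≤ ‖∑ i, t i • y i‖ ^ 2 := fun t => by
    have h1 : ⟪∑ i, t i • y i, ∑ j : Fin n, t j • e ((j : ℕ) + 1)⟫_ℝ = v * ∑ i, t i ^ 2 := by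
      simp only [sum_inner, inner_sum, real_inner_smul_left, real_inner_smul_right, hye]
      simp only [mul_ite, mul_zero, Finset.sum_ite_eq', Finset.mem_univ, if_true, Finset.mul_sum]
      exact Finset.sum_congr rfl fun i _ => by ring
    have h2 : ‖∑ j : Fin n, t j • e ((j : ℕ) + 1)‖ ^ 2 = v * ∑ i, t i ^ 2 := by
      rw [← real_inner_self_eq_norm_sq]
      simp only [sum_inner, inner_sum, real_inner_smul_left, real_inner_smul_right, he _ _,
        add_left_inj, Nat.cast_inj, Fin.val_inj]
      simp only [mul_ite, mul_zero, Finset.sum_ite_eq', Finset.mem_univ, if_true, Finset.mul_sum]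
      exact Finset.sum_congr rfl fun i _ => by ring
    have h3 := real_inner_mul_inner_self_le (∑ i, t i • y i) (∑ j : Fin n, t j • e ((j : ℕ) + 1))
    rw [h1, real_inner_self_eq_norm_sq, real_inner_self_eq_norm_sq, h2] at h3
    rcases eq_or_lt_of_le (show 0 ≤ v * ∑ i, t i ^ 2 by positivity) with h | h
    · rw [← h]; positivity
    · exact le_of_mul_le_mul_right h3 h
  obtain ⟨U, w, l, hU, hyw, hwy, hw, hl, hsum⟩ := exists_orthogonal_decomposition y hlow
  have hxy : ∀ j : Fin n, x ((j : ℕ) + 1) = ∑ i, B⁻¹ j i • y i := fun j => by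
    have hinv : B⁻¹ * B = 1 := Matrix.nonsing_inv_mul B (by rw [hB]; exact isUnit_one)
    simp only [y, Finset.smul_sum, smul_smul]
    rw [Finset.sum_comm]
    simp_rw [← Finset.sum_smul, ← Matrix.mul_apply, hinv]
    simp [Matrix.one_apply]
  refine ⟨B⁻¹ * U, w, l, ?_, fun j => ?_, fun k => ?_, hw, hl, ?_⟩
  · rw [Matrix.det_mul, abs_mul, hU, Matrix.det_nonsing_inv, hB]
    simp
  · rw [hxy]
    simp only [hyw, Finset.smul_sum, smul_smul]
    rw [Finset.sum_comm]
    simp_rw [← Finset.sum_smul, ← Matrix.mul_apply]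
  · rw [hwy]
    refine Submodule.sum_mem _ fun i _ => Submodule.smul_mem _ _ ?_
    exact Submodule.sum_mem _ fun j _ => Submodule.smul_mem _ _ (Submodule.subset_span ⟨_, rfl⟩)
  -- The norm depends only on the moving average coefficients, not on the time, so every residual
  -- may be moved to time 0.
  · rw [hsum, ← Fin.sum_univ_eq_sum_range (fun i : ℕ =>
      ‖∑ k ∈ Finset.range (i + 1), b k • x (0 - k)‖ ^ 2)]
    refine Finset.sum_congr rfl fun i _ => ?_
    exact ((hyma i).hasSum_sq he hv.le).unique
      ((IsMovingAverage.truncConv hx 0 (i + 1)).hasSum_sq he hv.le)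

end Diagonalization

/-! ### Differential entropy of Gaussian vectors -/

section Entropy

variable {Ω : Type*} [MeasurableSpace Ω] {P : Measure Ω}

/-- The Radon–Nikodym derivative agrees with `f` almost everywhere, and integrating `f log f`
against Lebesgue measure is integrating `log f` against the law. -/
lemma hasDifferentialEntropy_of_density {n : ℕ} {Y : Ω → Fin n → ℝ} {f : (Fin n → ℝ) → ℝ}
    (hY : AEMeasurable Y P) (hf : Measurable f) (hf0 : ∀ x, 0 ≤ f x)
    (hmap : P.map Y = volume.withDensity fun x => ENNReal.ofReal (f x))
    (hint : Integrable (fun x => Real.log (f x)) (P.map Y)) :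
    HasDifferentialEntropy P Y (-∫ x, Real.log (f x) ∂(P.map Y)) := by
  have hm : Measurable fun x => ENNReal.ofReal (f x) := hf.ennreal_ofReal
  have hfin : ∀ᵐ x ∂(volume : Measure (Fin n → ℝ)), ENNReal.ofReal (f x) < ⊤ :=
    Eventually.of_forall fun _ => ENNReal.ofReal_lt_top
  have hlaw : (fun x => lawDensity P Y x * Real.log (lawDensity P Y x)) =ᵐ[volume]
      fun x => (ENNReal.ofReal (f x)).toReal • Real.log (f x) := by
    have := Measure.rnDeriv_withDensity volume hm
    rw [← hmap] at this
    filter_upwards [this] with x hx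
    simp only [lawDensity, hx, smul_eq_mul, ENNReal.toReal_ofReal (hf0 x)]
  refine ⟨hY, ?_, ?_, ?_⟩
  · rw [hmap]; exact withDensity_absolutelyContinuous _ _
  · rw [integrable_congr hlaw, ← integrable_withDensity_iff_integrable_smul' hm hfin, ← hmap]
    exact hint
  · rw [integral_congr_ae hlaw, ← integral_withDensity_eq_integral_toReal_smul hm hfin, ← hmap]

lemma pi_withDensity_ofReal {n : ℕ} {g : Fin n → ℝ → ℝ} (hg : ∀ i, Integrable (g i))
    (hg0 : ∀ i x, 0 ≤ g i x) :
    Measure.pi (fun i => (volume : Measure ℝ).withDensity fun x => ENNReal.ofReal (g i x)) =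
      volume.withDensity fun x : Fin n → ℝ => ENNReal.ofReal (∏ i, g i (x i)) := by
  have : ∀ i, IsFiniteMeasure ((volume : Measure ℝ).withDensity fun x => ENNReal.ofReal (g i x)) :=
    fun i => isFiniteMeasure_withDensity_ofReal (hg i).2
  refine Measure.pi_eq fun s hs => ?_
  rw [withDensity_apply _ (MeasurableSet.univ_pi hs), volume_pi, Measure.restrict_pi_pi,
    ← ofReal_integral_eq_lintegral_ofReal, integral_fintype_prod_eq_prod,
    ENNReal.ofReal_prod_of_nonneg fun i _ => integral_nonneg (hg0 i)]
  · refine Finset.prod_congr rfl fun i _ => ?_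
    rw [withDensity_apply _ (hs i), ofReal_integral_eq_lintegral_ofReal (hg i).restrict
      (Eventually.of_forall (hg0 i))]
  · exact Integrable.fintype_prod fun i => (hg i).restrict
  · exact Eventually.of_forall fun x => Finset.prod_nonneg fun i _ => hg0 i _

lemma measurePreserving_mulVec {n : ℕ} {A : Matrix (Fin n) (Fin n) ℝ} (hA : |A.det| = 1) :
    MeasurePreserving (fun x : Fin n → ℝ => A.mulVec x) volume volume := by
  have h0 : A.det ≠ 0 := fun h => by simp [h] at hA
  refine ⟨?_, ?_⟩
  · exact (LinearMap.continuous_on_pi (Matrix.toLin' A)).measurable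
  · have := Real.map_matrix_volume_pi_eq_smul_volume_pi h0
    rw [abs_inv, hA, inv_one, ENNReal.ofReal_one, one_smul] at this
    exact this

lemma log_gaussianPDFReal {v : NNReal} (hv : 0 < v) (x : ℝ) :
    Real.log (gaussianPDFReal 0 v x) = -(1 / 2) * Real.log (2 * Real.pi * v) - x ^ 2 / (2 * v) := by
  have : (0 : ℝ) < 2 * Real.pi * v := by positivity
  rw [gaussianPDFReal, Real.log_mul (by positivity) (Real.exp_ne_zero _), Real.log_exp,
    Real.log_inv, Real.log_sqrt this.le]
  ring

lemma integrable_sq_gaussianReal (v : NNReal) : Integrable (fun x : ℝ => x ^ 2) (gaussianReal 0 v) :=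
  (memLp_id_gaussianReal' 2 (by simp)).integrable_sq

lemma integral_sq_gaussianReal (v : NNReal) : ∫ x : ℝ, x ^ 2 ∂(gaussianReal 0 v) = v := by
  rw [← variance_id_gaussianReal (μ := 0) (v := v), variance_of_integral_eq_zero aemeasurable_id]
  · rfl
  · exact integral_id_gaussianReal

lemma integrable_log_gaussianPDFReal {v : NNReal} (hv : 0 < v) :
    Integrable (fun x => Real.log (gaussianPDFReal 0 v x)) (gaussianReal 0 v) := by
  simp_rw [log_gaussianPDFReal hv]
  exact (integrable_const _).sub ((integrable_sq_gaussianReal v).div_const _)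

lemma integral_log_gaussianPDFReal {v : NNReal} (hv : 0 < v) :
    ∫ x, Real.log (gaussianPDFReal 0 v x) ∂(gaussianReal 0 v) =
      -(1 / 2 * Real.log (2 * Real.pi * Real.exp 1 * v)) := by
  simp_rw [log_gaussianPDFReal hv]
  rw [integral_sub (integrable_const _) ((integrable_sq_gaussianReal v).div_const _),
    integral_div, integral_sq_gaussianReal]
  have hv' : (0 : ℝ) < v := hv
  rw [show 2 * Real.pi * Real.exp 1 * v = 2 * Real.pi * v * Real.exp 1 by ring,
    Real.log_mul (by positivity) (Real.exp_ne_zero _), Real.log_exp]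
  simp
  field_simp
  ring

/-- The entropy of the image of independent Gaussian variables under a volume preserving matrix. -/
lemma hasDifferentialEntropy_mulVec {n : ℕ} {X W : Ω → Fin n → ℝ} {l : Fin n → NNReal}
    (hl : ∀ i, 0 < l i) (hW : HasLaw W (Measure.pi fun i => gaussianReal 0 (l i)) P)
    {A : Matrix (Fin n) (Fin n) ℝ} (hA : |A.det| = 1) (hX : X =ᵐ[P] fun ω => A.mulVec (W ω)) :
    HasDifferentialEntropy P X (∑ i, 1 / 2 * Real.log (2 * Real.pi * Real.exp 1 * l i)) := by
  set g : (Fin n → ℝ) → ℝ := fun x => ∏ i, gaussianPDFReal 0 (l i) (x i)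
  have hgm : Measurable g := Finset.measurable_prod _ fun i _ =>
    (measurable_gaussianPDFReal 0 (l i)).comp (measurable_pi_apply i)
  set μ : Measure (Fin n → ℝ) := Measure.pi fun i => gaussianReal 0 (l i)
  have hμ : μ = volume.withDensity fun x => ENNReal.ofReal (g x) := by
    rw [← pi_withDensity_ofReal (fun i => integrable_gaussianPDFReal 0 (l i))
      (fun i => gaussianPDFReal_nonneg 0 (l i))]
    simp only [μ]
    congr 1
    funext i
    rw [gaussianReal_of_var_ne_zero _ (hl i).ne']
    rfl
  have hmp := measurePreserving_mulVec hA
  have hu : IsUnit A.det := isUnit_iff_ne_zero.2 fun h => by simp [h] at hA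
  have hA' : |A⁻¹.det| = 1 := by rw [Matrix.det_nonsing_inv]; simp [hA]
  have hmp' := measurePreserving_mulVec hA'
  have hinv : ∀ x, A⁻¹.mulVec (A.mulVec x) = x := fun x => by
    rw [Matrix.mulVec_mulVec, Matrix.nonsing_inv_mul A hu, Matrix.one_mulVec]
  have hXm : AEMeasurable X P := (hmp.measurable.comp_aemeasurable hW.aemeasurable).congr hX.symm
  have hmap : P.map X = μ.map fun x => A.mulVec x := by
    rw [Measure.map_congr hX, ← hW.map_eq,
      AEMeasurable.map_map_of_aemeasurable hmp.measurable.aemeasurable hW.aemeasurable]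
    rfl
  have hdens : P.map X = volume.withDensity fun x => ENNReal.ofReal (g (A⁻¹.mulVec x)) := by
    rw [hmap]
    ext s hs
    rw [Measure.map_apply hmp.measurable hs, hμ, withDensity_apply _ (hmp.measurable hs),
      withDensity_apply _ hs, ← hmp.setLIntegral_comp_preimage (f := fun x =>
        ENNReal.ofReal (g (A⁻¹.mulVec x))) hs (hgm.comp hmp'.measurable).ennreal_ofReal]
    simp only [hinv]
  have hlog : ∀ x, Real.log (g x) = ∑ i, Real.log (gaussianPDFReal 0 (l i) (x i)) := fun x =>
    Real.log_prod fun i _ => (gaussianPDFReal_pos 0 (l i) (x i) (hl i).ne').ne'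
  have hlm : Measurable fun x => Real.log (g (A⁻¹.mulVec x)) :=
    (hgm.comp hmp'.measurable).log
  have hli : ∀ i : Fin n, Integrable (fun x => Real.log (gaussianPDFReal 0 (l i) (x i))) μ :=
    fun i => integrable_comp_eval (μ := fun i => gaussianReal 0 (l i))
      (integrable_log_gaussianPDFReal (hl i))
  have hint : Integrable (fun x => Real.log (g (A⁻¹.mulVec x))) (P.map X) := by
    rw [hmap, integrable_map_measure hlm.aestronglyMeasurable hmp.measurable.aemeasurable]
    simp only [Function.comp_def, hinv, hlog]
    exact integrable_finsetSum _ fun i _ => hli i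
  have hval : -∫ x, Real.log (g (A⁻¹.mulVec x)) ∂(P.map X) =
      ∑ i, 1 / 2 * Real.log (2 * Real.pi * Real.exp 1 * l i) := by
    rw [hmap, integral_map hmp.measurable.aemeasurable hlm.aestronglyMeasurable]
    simp only [hinv, hlog]
    rw [integral_finsetSum _ fun i _ => hli i, ← Finset.sum_neg_distrib]
    refine Finset.sum_congr rfl fun i _ => ?_
    rw [integral_comp_eval (μ := fun i => gaussianReal 0 (l i))
      (f := fun x => Real.log (gaussianPDFReal 0 (l i) x))
      (integrable_log_gaussianPDFReal (hl i)).aestronglyMeasurable,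
      integral_log_gaussianPDFReal (hl i), neg_neg]
  rw [← hval]
  exact hasDifferentialEntropy_of_density hXm (hgm.comp hmp'.measurable)
    (fun x => Finset.prod_nonneg fun i _ => gaussianPDFReal_nonneg _ _ _) hdens hint

end Entropy

/-! ### The Gaussian space spanned by the innovations -/

section GaussianSpace

open scoped InnerProductSpace

variable {Ω : Type*} [MeasurableSpace Ω] {P : Measure Ω}

lemma IsGaussianWhiteNoise.memLp {ε : ℤ → Ω → ℝ} {v : NNReal} (h : IsGaussianWhiteNoise P ε v)
    (n : ℤ) : MemLp (ε n) 2 P := by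
  have h1 : MemLp id 2 (P.map (ε n)) := by
    rw [(h.hasLaw n).map_eq]; exact memLp_id_gaussianReal' 2 (by simp)
  exact h1.comp_of_map (h.hasLaw n).aemeasurable

/-- The innovations as vectors in `L²`. -/
noncomputable def IsGaussianWhiteNoise.toL2 {ε : ℤ → Ω → ℝ} {v : NNReal}
    (h : IsGaussianWhiteNoise P ε v) (n : ℤ) : Lp ℝ 2 P := (h.memLp n).toLp

lemma IsGaussianWhiteNoise.isWhite {ε : ℤ → Ω → ℝ} {v : NNReal} (h : IsGaussianWhiteNoise P ε v) :
    IsWhite h.toL2 v := by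
  intro i j
  have e : ⟪h.toL2 i, h.toL2 j⟫_ℝ = ∫ ω, ε i ω * ε j ω ∂P := by
    rw [L2.inner_def]
    refine integral_congr_ae ?_
    filter_upwards [(h.memLp i).coeFn_toLp, (h.memLp j).coeFn_toLp] with ω h1 h2
    simp only [IsGaussianWhiteNoise.toL2, h1, h2, RCLike.inner_apply, conj_trivial]
    ring
  have hmean : ∀ n, ∫ ω, ε n ω ∂P = 0 := fun n => by
    rw [(h.hasLaw n).integral_eq, integral_id_gaussianReal]
  rw [e]
  split_ifs with hij
  · subst hij
    have := (h.hasLaw i).variance_eq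
    rw [variance_id_gaussianReal, variance_of_integral_eq_zero (h.hasLaw i).aemeasurable
      (hmean i)] at this
    simpa [sq] using this
  · have := (h.indep.indepFun hij).integral_mul_eq_mul_integral (h.memLp i).1 (h.memLp j).1
    rw [hmean, zero_mul] at this
    exact this

/-- `f` has a centered Gaussian characteristic function, of variance its squared `L²` norm. -/
def HasGaussianCharFun (f : Lp ℝ 2 P) : Prop :=
  ∀ t : ℝ, ∫ ω, Complex.exp (t * f ω * Complex.I) ∂P = Complex.exp (-(‖f‖ ^ 2 * t ^ 2 / 2))

lemma norm_exp_sub_exp_le (x y : ℝ) :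
    ‖Complex.exp (x * Complex.I) - Complex.exp (y * Complex.I)‖ ≤ |x - y| := by
  have h : Complex.exp (x * Complex.I) - Complex.exp (y * Complex.I) =
      Complex.exp (y * Complex.I) * (Complex.exp (Complex.I * ((x - y : ℝ) : ℂ)) - 1) := by
    rw [mul_sub, ← Complex.exp_add, mul_one]
    congr 2
    push_cast
    ring
  rw [h, norm_mul, Complex.norm_exp_ofReal_mul_I, one_mul]
  exact Real.norm_exp_I_mul_ofReal_sub_one_le

lemma aestronglyMeasurable_exp {f : Ω → ℝ} (hf : AEStronglyMeasurable f P) (t : ℝ) :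
    AEStronglyMeasurable (fun ω => Complex.exp (t * f ω * Complex.I)) P :=
  (by fun_prop : Continuous fun x : ℝ => Complex.exp (t * x * Complex.I)).comp_aestronglyMeasurable
    hf

lemma integrable_exp [IsProbabilityMeasure P] {f : Ω → ℝ} (hf : AEStronglyMeasurable f P) (t : ℝ) :
    Integrable (fun ω => Complex.exp (t * f ω * Complex.I)) P := by
  refine Integrable.of_bound (aestronglyMeasurable_exp hf t) 1 (Eventually.of_forall fun ω => ?_)
  rw [← Complex.ofReal_mul, Complex.norm_exp_ofReal_mul_I]

lemma integral_abs_le_norm [IsProbabilityMeasure P] (f : Lp ℝ 2 P) : ∫ ω, |f ω| ∂P ≤ ‖f‖ := by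
  have h1 : ∫ ω, |f ω| ∂P = (eLpNorm f 1 P).toReal := by
    rw [eLpNorm_one_eq_lintegral_enorm, ← integral_norm_eq_lintegral_enorm
      (Lp.aestronglyMeasurable f)]
    rfl
  rw [h1, Lp.norm_def]
  exact ENNReal.toReal_mono (Lp.eLpNorm_ne_top f)
    (eLpNorm_le_eLpNorm_of_exponent_le (by norm_num) (Lp.aestronglyMeasurable f))

/-- The map is `|t|`-Lipschitz, as `x ↦ exp (ix)` is 1-Lipschitz and the `L¹` norm is at most the
`L²` norm. Hence Gaussianity is a closed condition in `L²` and passes from finite sums of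
innovations to their limits. -/
lemma continuous_integral_exp [IsProbabilityMeasure P] (t : ℝ) :
    Continuous fun f : Lp ℝ 2 P => ∫ ω, Complex.exp (t * f ω * Complex.I) ∂P := by
  refine (LipschitzWith.of_dist_le_mul (K := ⟨|t|, abs_nonneg t⟩) fun f g => ?_).continuous
  rw [dist_eq_norm, dist_eq_norm, ← integral_sub (integrable_exp (Lp.aestronglyMeasurable f) t)
    (integrable_exp (Lp.aestronglyMeasurable g) t)]
  have hi : Integrable (fun ω => |t| * |(f - g : Lp ℝ 2 P) ω|) P :=
    ((Lp.memLp (f - g)).integrable (by norm_num)).abs.const_mul _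
  calc _ ≤ ∫ ω, |t| * |(f - g : Lp ℝ 2 P) ω| ∂P := by
        refine norm_integral_le_of_norm_le hi ?_
        filter_upwards [Lp.coeFn_sub f g] with ω hω
        have := norm_exp_sub_exp_le (t * f ω) (t * g ω)
        rw [← mul_sub, abs_mul] at this
        rw [hω]
        simpa using this
    _ ≤ |t| * ‖f - g‖ := by
        rw [integral_const_mul]
        exact mul_le_mul_of_nonneg_left (integral_abs_le_norm _) (abs_nonneg _)

lemma isClosed_hasGaussianCharFun [IsProbabilityMeasure P] :
    IsClosed {f : Lp ℝ 2 P | HasGaussianCharFun f} := by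
  simp only [HasGaussianCharFun, Set.ofPred_forall]
  refine isClosed_iInter fun t => isClosed_eq (continuous_integral_exp t) ?_
  fun_prop

lemma IsGaussianWhiteNoise.hasGaussianCharFun_sum {ε : ℤ → Ω → ℝ}
    {v : NNReal} (h : IsGaussianWhiteNoise P ε v) (s : Finset ℤ) (a : ℤ → ℝ) :
    HasGaussianCharFun (∑ i ∈ s, a i • h.toL2 i) := by
  intro t
  have hnorm : ‖∑ i ∈ s, a i • h.toL2 i‖ ^ 2 = ∑ i ∈ s, v * a i ^ 2 := by
    rw [← real_inner_self_eq_norm_sq]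
    simp only [sum_inner, inner_sum, real_inner_smul_left, real_inner_smul_right, h.isWhite _ _]
    refine Finset.sum_congr rfl fun i hi => ?_
    simp [hi]
    ring
  have hae : ⇑(∑ i ∈ s, a i • h.toL2 i) =ᵐ[P] fun ω => ∑ i ∈ s, a i * ε i ω := by
    have h1 : ∀ᵐ ω ∂P, ∀ i : ℤ, (a i • h.toL2 i : Lp ℝ 2 P) ω = a i * ε i ω := by
      rw [ae_all_iff]
      intro i
      filter_upwards [Lp.coeFn_smul (a i) (h.toL2 i), (h.memLp i).coeFn_toLp] with ω h2 h3
      rw [h2]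
      simp [IsGaussianWhiteNoise.toL2, h3]
    filter_upwards [Lp.coeFn_finsetSum s fun i => a i • h.toL2 i, h1] with ω h2 h3
    rw [h2, Finset.sum_apply]
    exact Finset.sum_congr rfl fun i _ => h3 i
  have hm : ∀ i, AEMeasurable (fun ω => a i * ε i ω) P := fun i =>
    (h.hasLaw i).aemeasurable.const_mul (a i)
  have hind : iIndepFun (fun i ω => a i * ε i ω) P :=
    h.indep.comp (fun i x => a i * x) fun i => measurable_const_mul (a i)
  have hlaw : ∀ i, P.map (fun ω => a i * ε i ω) = gaussianReal 0 (NNReal.mk (a i ^ 2) (sq_nonneg _) * v) :=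
    fun i => by
      have := gaussianReal_const_mul (h.hasLaw i) (a i)
      simpa using this.map_eq
  have hcf := congrFun (iIndepFun.charFun_map_fun_finsetSum_eq_prod (s := s) (fun i _ => hm i)
    (hind.restrict _)) t
  rw [charFun_apply_real, integral_map (Finset.aemeasurable_fun_sum s fun i _ => hm i)
    (by fun_prop)] at hcf
  have hstep : ∫ ω, Complex.exp (t * (∑ i ∈ s, a i • h.toL2 i : Lp ℝ 2 P) ω * Complex.I) ∂P =
      ∫ ω, Complex.exp (t * ((∑ i ∈ s, a i * ε i ω : ℝ) : ℂ) * Complex.I) ∂P := by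
    refine integral_congr_ae ?_
    filter_upwards [hae] with ω hω
    rw [hω]
  rw [hstep, hcf, Finset.prod_apply]
  simp_rw [hlaw, charFun_gaussianReal]
  rw [← Complex.exp_sum, ← Complex.ofReal_pow ‖_‖, hnorm]
  congr 1
  push_cast
  rw [Finset.sum_mul, Finset.sum_div, ← Finset.sum_neg_distrib]
  refine Finset.sum_congr rfl fun i _ => ?_
  ring

lemma IsGaussianWhiteNoise.hasGaussianCharFun [IsProbabilityMeasure P] {ε : ℤ → Ω → ℝ}
    {v : NNReal} (h : IsGaussianWhiteNoise P ε v) {f : Lp ℝ 2 P}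
    (hf : f ∈ (Submodule.span ℝ (Set.range h.toL2)).topologicalClosure) :
    HasGaussianCharFun f := by
  refine closure_minimal (t := {f : Lp ℝ 2 P | HasGaussianCharFun f}) (fun g hg => ?_)
    isClosed_hasGaussianCharFun hf
  obtain ⟨c, rfl⟩ := Finsupp.mem_span_range_iff_exists_finsupp.1 hg
  exact h.hasGaussianCharFun_sum _ _

lemma HasGaussianCharFun.hasLaw [IsProbabilityMeasure P] {f : Lp ℝ 2 P}
    (hf : HasGaussianCharFun f) : HasLaw f (gaussianReal 0 (‖f‖₊ ^ 2)) P := by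
  have hm : AEMeasurable f P := (Lp.aestronglyMeasurable f).aemeasurable
  refine ⟨hm, ?_⟩
  have := Measure.isProbabilityMeasure_map hm
  refine Measure.ext_of_charFun (funext fun t => ?_)
  rw [charFun_apply_real, integral_map hm (by fun_prop), hf t, charFun_gaussianReal]
  simp

/-- Orthogonal vectors of a Gaussian space are independent Gaussian variables. -/
lemma hasLaw_pi_of_orthogonal [IsProbabilityMeasure P] {n : ℕ} {w : Fin n → Lp ℝ 2 P}
    {l : Fin n → NNReal} (hw : ∀ i j, ⟪w i, w j⟫_ℝ = if i = j then (l i : ℝ) else 0)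
    (hG : ∀ t : Fin n → ℝ, HasGaussianCharFun (∑ i, t i • w i)) :
    HasLaw (fun ω i => w i ω) (Measure.pi fun i => gaussianReal 0 (l i)) P := by
  have hm : AEMeasurable (fun ω i => w i ω) P :=
    aemeasurable_pi_lambda _ fun i => (Lp.aestronglyMeasurable (w i)).aemeasurable
  refine ⟨hm, ?_⟩
  have := Measure.isProbabilityMeasure_map hm
  refine Measure.ext_of_charFunDual (funext fun L => ?_)
  rw [charFunDual_pi, charFunDual_apply, integral_map hm (by fun_prop)]
  set t : Fin n → ℝ := fun i => L (Pi.single i 1)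
  have hL : ∀ x, L x = ∑ i, t i * x i := fun x => by
    conv_lhs => rw [← Finset.univ_sum_single x]
    rw [map_sum]
    refine Finset.sum_congr rfl fun i _ => ?_
    have : (Pi.single i (x i) : Fin n → ℝ) = x i • Pi.single i 1 := by
      rw [← Pi.single_smul, smul_eq_mul, mul_one]
    rw [this, map_smul, smul_eq_mul, mul_comm]
  have hnorm : ‖∑ i, t i • w i‖ ^ 2 = ∑ i, l i * t i ^ 2 := by
    rw [← real_inner_self_eq_norm_sq]
    simp only [sum_inner, inner_sum, real_inner_smul_left, real_inner_smul_right, hw _ _]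
    refine Finset.sum_congr rfl fun i hi => ?_
    simp
    ring
  have hae : ⇑(∑ i, t i • w i) =ᵐ[P] fun ω => ∑ i, t i * w i ω := by
    have h1 : ∀ᵐ ω ∂P, ∀ i, (t i • w i : Lp ℝ 2 P) ω = t i * w i ω := by
      rw [ae_all_iff]
      intro i
      filter_upwards [Lp.coeFn_smul (t i) (w i)] with ω h2
      rw [h2]; simp
    filter_upwards [Lp.coeFn_finsetSum Finset.univ fun i => t i • w i, h1] with ω h2 h3
    rw [h2, Finset.sum_apply]
    exact Finset.sum_congr rfl fun i _ => h3 i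
  -- The joint characteristic function at `L` is that of the scalar variable `∑ t i • w i` at 1;
  -- orthogonality then splits its exponent over the coordinates.
  have h1 : ∫ ω, Complex.exp (L (fun i => w i ω) * Complex.I) ∂P =
      Complex.exp (-(‖∑ i, t i • w i‖ ^ 2 * (1 : ℝ) ^ 2 / 2)) := by
    rw [← hG t 1]
    refine integral_congr_ae ?_
    filter_upwards [hae] with ω hω
    rw [hω, hL]
    simp
  rw [h1]
  have h2 : ∀ i, charFunDual (gaussianReal 0 (l i)) (L ∘SL ContinuousLinearMap.single ℝ (fun _ : Fin n => ℝ) i) =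
      Complex.exp (-(l i * t i ^ 2 / 2)) := fun i => by
    have := charFun_gaussianReal (μ := 0) (v := l i) (t i)
    rw [charFun_apply_real] at this
    rw [charFunDual_apply]
    refine (integral_congr_ae (Eventually.of_forall fun x => ?_)).trans (this.trans ?_)
    · simp only [ContinuousLinearMap.comp_apply, ContinuousLinearMap.single_apply, hL]
      simp [Pi.single_apply]
    · simp
  simp_rw [h2]
  rw [← Complex.exp_sum, ← Complex.ofReal_pow ‖_‖, hnorm]
  congr 1
  push_cast
  rw [one_pow, mul_one, Finset.sum_div, ← Finset.sum_neg_distrib]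

end GaussianSpace

/-! ### Variance and entropy rate of an ARFIMA process -/

section EntropyRate

open scoped InnerProductSpace

variable {Ω : Type*} [MeasurableSpace Ω] {P : Measure Ω}

lemma hasMeanSquareSum_iff {Y : ℕ → Ω → ℝ} {Z : Ω → ℝ} {f : ℕ → Lp ℝ 2 P} {F : Lp ℝ 2 P}
    (hf : ∀ k, f k =ᵐ[P] Y k) (hF : F =ᵐ[P] Z) :
    HasMeanSquareSum P Y Z ↔
      Tendsto (fun N : ℕ => ∑ k ∈ Finset.range N, f k) atTop (𝓝 F) := by
  rw [Lp.tendsto_Lp_iff_tendsto_eLpNorm', HasMeanSquareSum]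
  refine tendsto_congr fun N => ?_
  rw [← eLpNorm_neg]
  refine eLpNorm_congr_ae ?_
  have h1 : ∀ᵐ ω ∂P, ∀ k, f k ω = Y k ω := ae_all_iff.2 hf
  filter_upwards [Lp.coeFn_finsetSum (Finset.range N) f, h1, hF] with ω h2 h3 h4
  simp only [Pi.neg_apply, Pi.sub_apply, h2, h4, Finset.sum_apply, h3, neg_sub]

lemma hasMeanSquareSum_smul_iff {a : ℕ → ℝ} {V : ℕ → Ω → ℝ} {Z : Ω → ℝ} {f : ℕ → Lp ℝ 2 P}
    {F : Lp ℝ 2 P} (hf : ∀ k, f k =ᵐ[P] V k) (hF : F =ᵐ[P] Z) :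
    HasMeanSquareSum P (fun k ω => a k * V k ω) Z ↔
      Tendsto (fun N : ℕ => ∑ k ∈ Finset.range N, a k • f k) atTop (𝓝 F) := by
  refine hasMeanSquareSum_iff (fun k => ?_) hF
  filter_upwards [Lp.coeFn_smul (a k) (f k), hf k] with ω h1 h2
  rw [h1, Pi.smul_apply, h2, smul_eq_mul]

/-- One partial sum at finite `L²` distance suffices. The definition of the process does not ask for
square integrability; it comes from causality through this lemma. -/
lemma HasMeanSquareSum.memLp {Y : ℕ → Ω → ℝ} {Z : Ω → ℝ} (h : HasMeanSquareSum P Y Z)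
    (hZ : AEStronglyMeasurable Z P) (hY : ∀ k, MemLp (Y k) 2 P) : MemLp Z 2 P := by
  obtain ⟨N, hN⟩ := (h.eventually_lt_const (u := 1) (by norm_num)).exists
  have hS : MemLp (fun ω => ∑ k ∈ Finset.range N, Y k ω) 2 P := memLp_finsetSum _ fun k _ => hY k
  have hD : MemLp (fun ω => Z ω - ∑ k ∈ Finset.range N, Y k ω) 2 P :=
    ⟨hZ.sub hS.1, hN.trans (by norm_num)⟩
  exact (hD.add hS).ae_eq (Eventually.of_forall fun ω => sub_add_cancel _ _)

variable {d : ℝ} {X ε : ℤ → Ω → ℝ} {v : NNReal}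

/-- An ARFIMA process as a sequence of vectors of `L²`. -/
lemma IsARFIMAWithNoise.exists_isMovingAverage (h : IsARFIMAWithNoise P d X ε v) :
    ∃ x : ℤ → Lp ℝ 2 P, (∀ n, x n =ᵐ[P] X n) ∧
      (∀ n, IsMovingAverage h.noise.toL2 (fracDiffCoeff (-d)) n (x n)) ∧
      ∀ n, Tendsto (fun N : ℕ => ∑ k ∈ Finset.range N, fracDiffCoeff d k • x (n - k)) atTop
        (𝓝 (h.noise.toL2 n)) := by
  obtain ⟨c, hc⟩ := h.causal
  have hX : ∀ n, MemLp (X n) 2 P := fun n =>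
    (hc n).memLp (h.aemeasurable n).aestronglyMeasurable fun k => (h.noise.memLp _).const_mul _
  have hε : ∀ n, h.noise.toL2 n =ᵐ[P] ε n := fun n => (h.noise.memLp n).coeFn_toLp
  set x : ℤ → Lp ℝ 2 P := fun n => (hX n).toLp
  have hx : ∀ n, x n =ᵐ[P] X n := fun n => (hX n).coeFn_toLp
  have hma : ∀ n, IsMovingAverage h.noise.toL2 c n (x n) := fun n =>
    (hasMeanSquareSum_smul_iff (fun k => hε (n - k)) (hx n)).1 (hc n)
  have hinv : ∀ n, Tendsto (fun N : ℕ => ∑ k ∈ Finset.range N, fracDiffCoeff d k • x (n - k)) atTop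
      (𝓝 (h.noise.toL2 n)) := fun n =>
    (hasMeanSquareSum_smul_iff (fun k => hx (n - k)) (hε n)).1 (h.fracDiff_eq n)
  -- Both sequences are inverse to `fracDiffCoeff d` under Cauchy products.
  have hc' : c = fracDiffCoeff (-d) := by
    refine eq_of_cauchyProduct_eq (fracDiffCoeff_zero d) fun m => ?_
    rw [sum_fracDiffCoeff_mul_neg, cauchyProduct_eq_of_inverse h.noise.isWhite
      (by exact_mod_cast h.noise.var_pos.ne') hma (hinv 0)]
  exact ⟨x, hx, hc' ▸ hma, hinv⟩

lemma IsMovingAverage.mem_topologicalClosure {E : Type*} [NormedAddCommGroup E]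
    [InnerProductSpace ℝ E] {e : ℤ → E} {c : ℕ → ℝ} {n : ℤ} {x : E}
    (hx : IsMovingAverage e c n x) : x ∈ (Submodule.span ℝ (Set.range e)).topologicalClosure :=
  mem_closure_of_tendsto hx (Eventually.of_forall fun _ =>
    Submodule.sum_mem _ fun _ _ => Submodule.smul_mem _ _ (Submodule.subset_span ⟨_, rfl⟩))

lemma variance_eq_of_isMovingAverage [IsProbabilityMeasure P] {c : ℕ → ℝ}
    (hε : IsGaussianWhiteNoise P ε v) {n : ℤ} {x : Lp ℝ 2 P}
    (hx : IsMovingAverage hε.toL2 c n x) {Z : Ω → ℝ} (hxX : x =ᵐ[P] Z) :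
    variance Z P = v * ∑' k, c k ^ 2 := by
  rw [← variance_congr hxX, (hε.hasGaussianCharFun hx.mem_topologicalClosure).hasLaw.variance_eq,
    variance_id_gaussianReal, ← tsum_mul_left, (hx.hasSum_sq hε.isWhite v.2).tsum_eq]
  simp

lemma IsARFIMAWithNoise.hasDifferentialEntropyRate [IsProbabilityMeasure P]
    (h : IsARFIMAWithNoise P d X ε v) :
    HasDifferentialEntropyRate P X (1 / 2 * Real.log (2 * Real.pi * Real.exp 1 * v)) := by
  obtain ⟨x, hxX, hx, hinv⟩ := h.exists_isMovingAverage
  have hv : (0 : ℝ) < v := h.noise.var_pos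
  set r : ℕ → ℝ := fun i => ‖∑ k ∈ Finset.range (i + 1), fracDiffCoeff d k • x (0 - k)‖ ^ 2
  set R := 1 / 2 * Real.log (2 * Real.pi * Real.exp 1 * v)
  have hr : Tendsto r atTop (𝓝 v) := by
    rw [← h.noise.isWhite.norm_sq 0]
    exact (((hinv 0).comp (tendsto_add_atTop_nat 1)).norm).pow 2
  -- The lower bound comes from `v ≤ l k`. The upper one comes from `log (l k / v) ≤ l k / v - 1`,
  -- which makes it depend on the eigenvalues only through their sum `∑ r i`.
  have key : ∀ n : ℕ, ∃ a : ℝ,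
      HasDifferentialEntropy P (fun ω (i : Fin n) => X (((i : ℕ) : ℤ) + 1) ω) a ∧ n * R ≤ a ∧
        a ≤ n * R + 1 / 2 * ((∑ i ∈ Finset.range n, r i) / v - n) := by
    intro n
    obtain ⟨A, w, l, hA, hxw, hspan, hw, hl, hsum⟩ := exists_block_decomposition h.noise.isWhite hv
      (fracDiffCoeff_zero d) (sum_fracDiffCoeff_mul_neg d) hx n
    have hl0 : ∀ i, 0 < l i := fun i => hv.trans_le (hl i)
    have hcoe : ∀ i, ((l i).toNNReal : ℝ) = l i := fun i => Real.coe_toNNReal _ (hl0 i).le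
    have hle : Submodule.span ℝ (Set.range x) ≤
        (Submodule.span ℝ (Set.range h.noise.toL2)).topologicalClosure := by
      rw [Submodule.span_le]
      rintro _ ⟨n, rfl⟩
      exact (hx n).mem_topologicalClosure
    have hlaw := hasLaw_pi_of_orthogonal (P := P) (w := w) (l := fun i => (l i).toNNReal)
      (fun i j => by rw [hw, hcoe]) fun t => h.noise.hasGaussianCharFun
        (Submodule.sum_mem _ fun k _ => Submodule.smul_mem _ _ (hle (hspan k)))
    have hXA : (fun ω (i : Fin n) => X (((i : ℕ) : ℤ) + 1) ω) =ᵐ[P]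
        fun ω => A.mulVec fun i => w i ω := by
      have h1 : ∀ᵐ ω ∂P, ∀ i : Fin n, X (((i : ℕ) : ℤ) + 1) ω = ∑ k, A i k * w k ω := by
        rw [ae_all_iff]
        intro i
        have h2 : ∀ᵐ ω ∂P, ∀ k, (A i k • w k : Lp ℝ 2 P) ω = A i k * w k ω := by
          rw [ae_all_iff]
          intro k
          filter_upwards [Lp.coeFn_smul (A i k) (w k)] with ω h3
          rw [h3]; simp
        have h3 := hxX ((i : ℕ) + 1)
        rw [hxw] at h3
        filter_upwards [h2, h3, Lp.coeFn_finsetSum Finset.univ fun k => A i k • w k] with ω h4 h5 h6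
        rw [← h5, h6, Finset.sum_apply]
        exact Finset.sum_congr rfl fun k _ => h4 k
      filter_upwards [h1] with ω hω
      funext i
      exact hω i
    refine ⟨_, hasDifferentialEntropy_mulVec (fun i => Real.toNNReal_pos.2 (hl0 i)) hlaw hA hXA,
      ?_, ?_⟩
    · calc n * R = ∑ _i : Fin n, R := by simp
        _ ≤ _ := Finset.sum_le_sum fun i _ => by
          simp only [R, hcoe]
          have := hl i
          gcongr
    · have hb : ∀ i, 1 / 2 * Real.log (2 * Real.pi * Real.exp 1 * (l i).toNNReal) ≤
          R + 1 / 2 * (l i / v - 1) := fun i => by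
        have h1 := Real.log_le_sub_one_of_pos (div_pos (hl0 i) hv)
        rw [Real.log_div (hl0 i).ne' hv.ne'] at h1
        have hc : 2 * Real.pi * Real.exp 1 ≠ 0 := by positivity
        simp only [R, hcoe]
        rw [Real.log_mul hc (hl0 i).ne', Real.log_mul hc hv.ne']
        linarith
      refine (Finset.sum_le_sum fun i _ => hb i).trans_eq ?_
      rw [Finset.sum_add_distrib, ← Finset.mul_sum (f := fun i => l i / (v : ℝ) - 1),
        Finset.sum_sub_distrib, ← Finset.sum_div, hsum]
      simp [r]
  choose a ha hlow hup using key
  refine ⟨a, ha, ?_⟩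
  -- Since `r i → v`, the Cesàro means tend to `v` and the excess over `R` vanishes.
  have hup_lim : Tendsto (fun n : ℕ => R + 1 / 2 *
      (((n : ℝ)⁻¹ * ∑ i ∈ Finset.range n, r i) / v - 1)) atTop (𝓝 (R + 1 / 2 * (v / v - 1))) :=
    ((((hr.cesaro).div_const _).sub_const _).const_mul _).const_add _
  rw [div_self hv.ne', sub_self, mul_zero, add_zero] at hup_lim
  refine tendsto_of_tendsto_of_tendsto_of_le_of_le' tendsto_const_nhds hup_lim ?_ ?_
  · filter_upwards [eventually_gt_atTop 0] with n hn
    have hn' : (0 : ℝ) < n := by exact_mod_cast hn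
    rw [le_div_iff₀ hn', mul_comm]
    exact hlow n
  · filter_upwards [eventually_gt_atTop 0] with n hn
    have hn' : (0 : ℝ) < n := by exact_mod_cast hn
    rw [div_le_iff₀ hn']
    refine (hup n).trans_eq ?_
    field_simp

lemma IsARFIMAWithNoise.variance_eq [IsProbabilityMeasure P] (h : IsARFIMAWithNoise P d X ε v)
    (hd : -1 < d) (hd' : d < 1 / 2) (n : ℤ) :
    variance (X n) P = v * (Real.Gamma (1 - 2 * d) / Real.Gamma (1 - d) ^ 2) := by
  obtain ⟨x, hxX, hx, -⟩ := h.exists_isMovingAverage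
  rw [variance_eq_of_isMovingAverage h.noise (hx n) (hxX n),
    tsum_fracDiffCoeff_sq (by linarith) (by linarith)]
  ring_nf

end EntropyRate

/-! ### Construction of the process on path space -/

section Existence

lemma map_shift_infinitePi (μ : Measure ℝ) [IsProbabilityMeasure μ] (m : ℤ) :
    (Measure.infinitePi fun _ : ℤ => μ).map (fun ω k => ω (k + m)) =
      Measure.infinitePi fun _ : ℤ => μ := by
  have h := Measure.infinitePi_map_piCongrLeft (X := fun _ : ℤ => ℝ) (fun _ => μ)
    (Equiv.addRight m).symm
  have e : (MeasurableEquiv.piCongrLeft (fun _ : ℤ => ℝ) (Equiv.addRight m).symm : (ℤ → ℝ) → ℤ → ℝ)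
      = fun ω k => ω (k + m) := by
    funext ω k
    obtain ⟨j, rfl⟩ := (Equiv.addRight m).symm.surjective k
    rw [MeasurableEquiv.coe_piCongrLeft, Equiv.piCongrLeft_apply_apply]
    simp
  rw [e] at h
  exact h

/-- The law of an independent sequence of `N(0, v)` variables, on a space in a given universe. -/
noncomputable def noiseMeasure (v : NNReal) : Measure (ULift.{u} (ℤ → ℝ)) :=
  (Measure.infinitePi fun _ : ℤ => gaussianReal 0 v).map MeasurableEquiv.ulift.symm

instance (v : NNReal) : IsProbabilityMeasure (noiseMeasure.{u} v) :=
  Measure.isProbabilityMeasure_map MeasurableEquiv.ulift.symm.measurable.aemeasurable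

lemma measurable_ulift_down {α : Type*} [MeasurableSpace α] :
    Measurable (ULift.down : ULift.{u} α → α) := MeasurableEquiv.ulift.measurable

lemma map_down_noiseMeasure (v : NNReal) :
    (noiseMeasure.{u} v).map ULift.down = Measure.infinitePi fun _ : ℤ => gaussianReal 0 v := by
  rw [noiseMeasure, Measure.map_map measurable_ulift_down MeasurableEquiv.ulift.symm.measurable]
  exact Measure.map_id

/-- The time shift of a path. -/
def pathShift (m : ℤ) (ω : ULift.{u} (ℤ → ℝ)) : ULift.{u} (ℤ → ℝ) := ⟨fun k => ω.down (k + m)⟩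

lemma pathShift_add (n m : ℤ) (ω : ULift.{u} (ℤ → ℝ)) :
    pathShift (n + m) ω = pathShift n (pathShift m ω) := by
  simp only [pathShift, add_assoc]

lemma measurePreserving_pathShift (v : NNReal) (m : ℤ) :
    MeasurePreserving (pathShift.{u} m) (noiseMeasure v) (noiseMeasure v) := by
  have h1 : Measurable fun (ω : ℤ → ℝ) (k : ℤ) => ω (k + m) :=
    measurable_pi_lambda _ fun k => measurable_pi_apply _
  have h2 : Measurable (pathShift.{u} m) :=
    MeasurableEquiv.ulift.symm.measurable.comp (h1.comp measurable_ulift_down)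
  refine ⟨h2, ?_⟩
  have h3 : pathShift.{u} m ∘ MeasurableEquiv.ulift.symm =
      MeasurableEquiv.ulift.symm ∘ fun (ω : ℤ → ℝ) (k : ℤ) => ω (k + m) := rfl
  rw [noiseMeasure, Measure.map_map h2 MeasurableEquiv.ulift.symm.measurable, h3,
    ← Measure.map_map MeasurableEquiv.ulift.symm.measurable h1, map_shift_infinitePi]

lemma isGaussianWhiteNoise_noiseMeasure {v : NNReal} (hv : 0 < v) :
    IsGaussianWhiteNoise (noiseMeasure.{u} v) (fun n ω => ω.down n) v := by
  have hm : ∀ n : ℤ, Measurable fun ω : ULift.{u} (ℤ → ℝ) => ω.down n := fun n =>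
    (measurable_pi_apply n).comp measurable_ulift_down
  have hlaw : ∀ n : ℤ, (noiseMeasure.{u} v).map (fun ω => ω.down n) = gaussianReal 0 v := fun n => by
    have := Measure.infinitePi_map_eval (fun _ : ℤ => gaussianReal 0 v) n
    rw [← map_down_noiseMeasure.{u}, Measure.map_map (measurable_pi_apply n)
      measurable_ulift_down] at this
    exact this
  refine ⟨hv, fun n => ⟨(hm n).aemeasurable, hlaw n⟩, ?_⟩
  rw [iIndepFun_iff_map_fun_eq_infinitePi_map hm]
  simp_rw [hlaw]
  exact map_down_noiseMeasure v

lemma exists_isARFIMAWithNoise_of_shift {Ω : Type*} [MeasurableSpace Ω] {P : Measure Ω}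
    {d : ℝ} (hd : -1 / 2 < d) (hd' : d < 1 / 2) {ε : ℤ → Ω → ℝ} {v : NNReal}
    (hε : IsGaussianWhiteNoise P ε v) (hεm : ∀ n, Measurable (ε n)) {T : ℤ → Ω → Ω}
    (hT : ∀ m, MeasurePreserving (T m) P P) (hTadd : ∀ n m ω, T (n + m) ω = T n (T m ω))
    (hεT : ∀ n m ω, ε n (T m ω) = ε (n + m) ω) :
    ∃ X : ℤ → Ω → ℝ, IsARFIMAWithNoise P d X ε v := by
  have hεae : ∀ n, hε.toL2 n =ᵐ[P] ε n := fun n => (hε.memLp n).coeFn_toLp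
  obtain ⟨x₀, hx₀⟩ := hε.isWhite.exists_isMovingAverage
    (summable_fracDiffCoeff_sq (d := -d) (by linarith) (by linarith)) 0
  have hx₀m : Measurable x₀ := (Lp.stronglyMeasurable x₀).measurable
  -- Only time 0 is built as an `L²` limit. Transporting one measurable representative by the shifts
  -- makes strict stationarity follow from measure preservation.
  set X : ℤ → Ω → ℝ := fun n ω => x₀ (T n ω)
  have hXm : ∀ n, Measurable (X n) := fun n => hx₀m.comp (hT n).measurable
  have h0 : HasMeanSquareSum P (fun k ω => fracDiffCoeff (-d) k * ε (0 - (k : ℤ)) ω) x₀ :=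
    (hasMeanSquareSum_smul_iff (V := fun k => ε (0 - (k : ℤ)))
      (fun k => hεae (0 - k)) (EventuallyEq.refl _ _)).2 hx₀
  have hcausal : ∀ n : ℤ,
      HasMeanSquareSum P (fun k ω => fracDiffCoeff (-d) k * ε (n - (k : ℤ)) ω) (X n) := by
    intro n
    refine h0.congr fun N => ?_
    have hm : Measurable fun ω =>
        x₀ ω - ∑ k ∈ Finset.range N, fracDiffCoeff (-d) k * ε (0 - (k : ℤ)) ω :=
      hx₀m.sub (Finset.measurable_fun_sum _ fun k _ => (hεm _).const_mul _)
    rw [← eLpNorm_comp_measurePreserving hm.aestronglyMeasurable (hT n)]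
    congr 1
    funext ω
    simp only [Function.comp, X, hεT]
    congr 1
    refine Finset.sum_congr rfl fun k _ => ?_
    rw [show 0 - (k : ℤ) + n = n - k by ring]
  have hX : ∀ n, MemLp (X n) 2 P := fun n => (hcausal n).memLp (hXm n).aestronglyMeasurable
    fun k => (hε.memLp _).const_mul _
  have hxX : ∀ n, (hX n).toLp =ᵐ[P] X n := fun n => (hX n).coeFn_toLp
  have hma : ∀ n, IsMovingAverage hε.toL2 (fracDiffCoeff (-d)) n (hX n).toLp := fun n =>
    (hasMeanSquareSum_smul_iff (V := fun k => ε (n - (k : ℤ)))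
      (fun k => hεae (n - k)) (hxX n)).1 (hcausal n)
  refine ⟨X, fun n => (hXm n).aemeasurable, fun m => ?_, hε, fun n => ?_, _, hcausal⟩
  · have h1 : Measurable fun (ω : Ω) (n : ℤ) => X n ω := measurable_pi_lambda _ hXm
    have h2 : (fun (ω : Ω) (n : ℤ) => X (n + m) ω) = (fun ω n => X n ω) ∘ T m := by
      funext ω n
      simp only [X, hTadd, Function.comp]
    rw [h2, ← Measure.map_map h1 (hT m).measurable, (hT m).map_eq]
  · exact (hasMeanSquareSum_smul_iff (V := fun k => X (n - (k : ℤ))) (fun k => hxX (n - k))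
      (hεae n)).2 (tendsto_sum_fracDiffCoeff_smul hd hd' hε.isWhite v.2 hma n)

lemma exists_isARFIMAWithNoise {d : ℝ} (hd : -1 / 2 < d) (hd' : d < 1 / 2) {v : NNReal}
    (hv : 0 < v) : ∃ X : ℤ → ULift.{u} (ℤ → ℝ) → ℝ,
      IsARFIMAWithNoise (noiseMeasure v) d X (fun n ω => ω.down n) v :=
  exists_isARFIMAWithNoise_of_shift hd hd' (isGaussianWhiteNoise_noiseMeasure hv)
    (fun n => (measurable_pi_apply n).comp measurable_ulift_down)
    (measurePreserving_pathShift v) pathShift_add fun _ _ _ => rfl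

end Existence

/-! ### The entropy rate as a function of `H` -/

section Maximum

/-- The entropy rate of an ARFIMA(0, H - 1/2, 0) process of variance `s`. -/
noncomputable def arfimaEntropyRate (s H : ℝ) : ℝ :=
  1 / 2 * Real.log (2 * Real.pi * Real.exp 1 * s) + Real.log (Real.Gamma (3 / 2 - H)) -
    1 / 2 * Real.log (Real.Gamma (2 - 2 * H))

lemma arfimaEntropyRate_eq {s H v : ℝ} (hv : 0 < v) (hH : H < 1)
    (hs : v * (Real.Gamma (2 - 2 * H) / Real.Gamma (3 / 2 - H) ^ 2) = s) :
    arfimaEntropyRate s H = 1 / 2 * Real.log (2 * Real.pi * Real.exp 1 * v) := by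
  have h1 : 0 < Real.Gamma (2 - 2 * H) := Real.Gamma_pos_of_pos (by linarith)
  have h2 : 0 < Real.Gamma (3 / 2 - H) := Real.Gamma_pos_of_pos (by linarith)
  have hc : 2 * Real.pi * Real.exp 1 ≠ 0 := by positivity
  subst hs
  rw [arfimaEntropyRate, Real.log_mul hc (by positivity), Real.log_mul hc hv.ne',
    Real.log_mul hv.ne' (by positivity), Real.log_div h1.ne' (by positivity), Real.log_pow]
  push_cast
  ring

lemma hasDerivAt_arfimaEntropyRate (s : ℝ) {H : ℝ} (hH : H < 1) :
    HasDerivAt (arfimaEntropyRate s) (realDigamma (2 - 2 * H) - realDigamma (3 / 2 - H)) H := by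
  have h1 : HasDerivAt (fun H : ℝ => Real.log (Real.Gamma (3 / 2 - H)))
      (realDigamma (3 / 2 - H) * (-1)) H :=
    (hasDerivAt_log_Gamma (x := 3 / 2 - H) (by linarith)).comp H
      ((hasDerivAt_id H).const_sub (3 / 2))
  have h2 : HasDerivAt (fun H : ℝ => Real.log (Real.Gamma (2 - 2 * H)))
      (realDigamma (2 - 2 * H) * (-(2 * 1))) H :=
    HasDerivAt.comp (h := fun H : ℝ => 2 - 2 * H) H
      (hasDerivAt_log_Gamma (x := 2 - 2 * H) (by linarith))
      (((hasDerivAt_id H).const_mul 2).const_sub 2)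
  convert! (h1.const_add (1 / 2 * Real.log (2 * Real.pi * Real.exp 1 * s))).sub
    (h2.const_mul (1 / 2)) using 1
  ring

lemma realDigamma_sub_pos {H : ℝ} (hH : H < 1 / 2) :
    0 < realDigamma (2 - 2 * H) - realDigamma (3 / 2 - H) :=
  sub_pos.2 (realDigamma_strictMonoOn (Set.mem_Ioi.2 (by linarith)) (Set.mem_Ioi.2 (by linarith))
    (by linarith))

lemma realDigamma_sub_neg {H : ℝ} (hH : 1 / 2 < H) (hH' : H < 1) :
    realDigamma (2 - 2 * H) - realDigamma (3 / 2 - H) < 0 :=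
  sub_neg.2 (realDigamma_strictMonoOn (Set.mem_Ioi.2 (by linarith)) (Set.mem_Ioi.2 (by linarith))
    (by linarith))

/-- The digamma arguments `2 - 2H` and `3/2 - H` cross exactly at `H = 1/2`, so the rate increases
strictly before that point and decreases strictly after it. -/
lemma arfimaEntropyRate_lt (s : ℝ) {H : ℝ} (hH : H < 1) (hne : H ≠ 1 / 2) :
    arfimaEntropyRate s H < arfimaEntropyRate s (1 / 2) := by
  have hcont : ContinuousOn (arfimaEntropyRate s) (Set.Iio 1) := fun x hx =>
    (hasDerivAt_arfimaEntropyRate s hx).continuousAt.continuousWithinAt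
  rcases lt_or_gt_of_ne hne with h | h
  · refine strictMonoOn_of_deriv_pos (convex_Iic (1 / 2)) (hcont.mono fun x hx => ?_)
      (fun x hx => ?_) (Set.mem_Iic.2 h.le) (Set.mem_Iic.2 le_rfl) h
    · exact lt_of_le_of_lt (Set.mem_Iic.1 hx) (by norm_num)
    · rw [interior_Iic] at hx
      have hx' := Set.mem_Iio.1 hx
      rw [(hasDerivAt_arfimaEntropyRate s (by linarith)).deriv]
      exact realDigamma_sub_pos hx'
  · refine strictAntiOn_of_deriv_neg (convex_Ico (1 / 2) 1) (hcont.mono fun x hx => hx.2)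
      (fun x hx => ?_) ⟨le_rfl, by norm_num⟩ ⟨h.le, hH⟩ h
    rw [interior_Ico] at hx
    rw [(hasDerivAt_arfimaEntropyRate s hx.2).deriv]
    exact realDigamma_sub_neg hx.1 hx.2

end Maximum

theorem mainTheorem8 (σ2 : ℝ) (hσ2 : 0 < σ2) :
    ∃ h : ℝ → ℝ,
      -- for each Hurst parameter there is an ARFIMA(0, H - 1/2, 0) process of variance `σ2`
      (∀ H ∈ Set.Ioo (0 : ℝ) 1,
        ∃ (Ω : Type u) (_ : MeasurableSpace Ω) (P : Measure Ω) (_ : IsProbabilityMeasure P)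
          (X : ℤ → Ω → ℝ), IsARFIMA P (H - 1 / 2) X ∧ ∀ n, variance (X n) P = σ2) ∧
      -- and `h H` is the differential entropy rate of every such process
      (∀ H ∈ Set.Ioo (0 : ℝ) 1,
        ∀ (Ω : Type u) (_ : MeasurableSpace Ω) (P : Measure Ω) (_ : IsProbabilityMeasure P)
          (X : ℤ → Ω → ℝ), IsARFIMA P (H - 1 / 2) X → (∀ n, variance (X n) P = σ2) →
            HasDifferentialEntropyRate P X (h H)) ∧
      -- `H = 1/2` is the unique maximum point
      (∀ H ∈ Set.Ioo (0 : ℝ) 1, H ≠ 1 / 2 → h H < h (1 / 2)) ∧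
      -- the derivative of the entropy rate, and its only zero
      (∀ H ∈ Set.Ioo (0 : ℝ) 1,
        HasDerivAt h (realDigamma (2 - 2 * H) - realDigamma (3 / 2 - H)) H ∧
          (realDigamma (2 - 2 * H) - realDigamma (3 / 2 - H) = 0 ↔ H = 1 / 2)) := by
  refine ⟨arfimaEntropyRate σ2, fun H hH => ?_, fun H hH Ω _ P _ X hX hvar => ?_,
    fun H hH hne => arfimaEntropyRate_lt σ2 hH.2 hne,
    fun H hH => ⟨hasDerivAt_arfimaEntropyRate σ2 hH.2, fun h0 => ?_, ?_⟩⟩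
  · have h1 : 0 < Real.Gamma (1 - 2 * (H - 1 / 2)) := Real.Gamma_pos_of_pos (by linarith [hH.2])
    have h2 : 0 < Real.Gamma (1 - (H - 1 / 2)) := Real.Gamma_pos_of_pos (by linarith [hH.2])
    -- The innovation variance for which the variance formula gives `σ2`.
    set v : ℝ := σ2 * Real.Gamma (1 - (H - 1 / 2)) ^ 2 / Real.Gamma (1 - 2 * (H - 1 / 2))
    have hv : 0 < v := by positivity
    obtain ⟨X, hX⟩ := exists_isARFIMAWithNoise.{u} (d := H - 1 / 2) (by linarith [hH.1])
      (by linarith [hH.2]) (Real.toNNReal_pos.2 hv)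
    refine ⟨_, _, noiseMeasure v.toNNReal, inferInstance, X,
      ⟨by linarith [hH.1], by linarith [hH.2], _, _, hX⟩, fun n => ?_⟩
    rw [hX.variance_eq (by linarith [hH.1]) (by linarith [hH.2]), Real.coe_toNNReal _ hv.le]
    simp only [v]
    generalize Real.Gamma (1 - 2 * (H - 1 / 2)) = a at *
    generalize Real.Gamma (1 - (H - 1 / 2)) = b at *
    field_simp
  · obtain ⟨-, -, ε, v, h⟩ := hX
    have hv : (0 : ℝ) < v := h.noise.var_pos
    have h1 := h.variance_eq (by linarith [hH.1]) (by linarith [hH.2]) 0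
    rw [hvar, show 1 - 2 * (H - 1 / 2) = 2 - 2 * H by ring,
      show 1 - (H - 1 / 2) = 3 / 2 - H by ring] at h1
    rw [arfimaEntropyRate_eq hv hH.2 h1.symm]
    exact h.hasDifferentialEntropyRate
  · by_contra hne
    rcases lt_or_gt_of_ne hne with h | h
    · exact (realDigamma_sub_pos h).ne' h0
    · exact (realDigamma_sub_neg h hH.2).ne h0
  · rintro rfl
    norm_num
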